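/- Let $Q=\overline{U}_{\mathrm i}\,s\ell(2)$ be the restricted quantum group at $\mathfrak q=\mathrm i$, that is, the unital associative $\mathbb C$-algebra with generators $E,F,K^{\pm1}$ and relations $$KK^{-1}=K^{-1}K=1,\quad KEK^{-1}=-E,\quad KFK^{-1}=-F,\quad EF-FE=\frac{K-K^{-1}}{2\mathrm i},\quad E^2=F^2=0,\quad K^4=1,$$ with the Hopf algebra structure $$\Delta(E)=1\otimes E+E\otimes K,\quad \Delta(F)=K^{-1}\otimes F+F\otimes 1,\quad \Delta(K)=K\otimes K,$$ $$\epsilon(E)=\epsilon(F)=0,\quad \epsilon(K)=1,\quad S(E)=-EK^{-1},\quad S(F)=-KF,\quad S(K)=K^{-1}.$$ Let $\mathbf{Rep}\,Q$ be the monoidal category of finite-dimensional $Q$-modules, where $Q$ acts on $U\otimes V$ through $\Delta$ and on the tensor unit $\mathbb C$ through $\epsilon$, and the associativity and unit isomorphisms are those of vector spaces. Then: 1. $\dim_{\mathbb C}Q=16$. 2. $\mathbf{Rep}\,Q$ is not braidable: this monoidal category admits no braiding. 3. Equivalently, $Q$ has no universal R-matrix: there is no invertible $R\in Q\otimes Q$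 with $R\,\Delta(a)=\Delta^{\mathrm{op}}(a)\,R$ for all $a\in Q$, $(\Delta\otimes\mathrm{id})(R)=R_{13}R_{23}$ and $(\mathrm{id}\otimes\Delta)(R)=R_{13}R_{12}$. 4. Nevertheless, $U\otimes V\cong V\otimes U$ as $Q$-modules for all finite-dimensional $Q$-modules $U$ and $V$. -/

import Mathlib

open CategoryTheory MonoidalCategory
open scoped TensorProduct

noncomputable section

/-! ### The restricted quantum group of `sl(2)` at `q = i` -/

namespace RestrictedQuantumGroup

/-- The algebra generators `E`, `F`, `K`, `K⁻¹`. -/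
inductive Gen : Type
  | E | F | K | Kinv

/-- The free algebra on the generators. -/
abbrev Free : Type := FreeAlgebra ℂ Gen

/-- The image of a generator in the free algebra. -/
abbrev gen (g : Gen) : Free := FreeAlgebra.ι ℂ g

/-- The defining relations of the restricted quantum group at `q = i`
(so `q ^ 2 = q ^ (-2) = -1` and `q - q⁻¹ = 2 i`). -/
inductive Rel : Free → Free → Prop
  | K_Kinv : Rel (gen .K * gen .Kinv) 1
  | Kinv_K : Rel (gen .Kinv * gen .K) 1
  | K_E : Rel (gen .K * gen .E * gen .Kinv) (-gen .E)
  | K_F : Rel (gen .K * gen .F * gen .Kinv) (-gen .F)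
  | E_F : Rel (gen .E * gen .F - gen .F * gen .E)
      ((2 * Complex.I)⁻¹ • (gen .K - gen .Kinv))
  | E_sq : Rel (gen .E ^ 2) 0
  | F_sq : Rel (gen .F ^ 2) 0
  | K_four : Rel (gen .K ^ 4) 1

/-- The restricted quantum group `Q` of `sl(2)` at `q = i`, as a complex algebra. -/
def Q : Type := RingQuot Rel

instance : Ring Q := inferInstanceAs (Ring (RingQuot Rel))

instance : Algebra ℂ Q := inferInstanceAs (Algebra ℂ (RingQuot Rel))

namespace Q

/-- The quotient map from the free algebra. -/
def mk : Free →ₐ[ℂ] Q := RingQuot.mkAlgHom ℂ Rel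

/-- The generator `E` of `Q`. -/
def E : Q := mk (gen .E)
/-- The generator `F` of `Q`. -/
def F : Q := mk (gen .F)
/-- The generator `K` of `Q`. -/
def K : Q := mk (gen .K)
/-- The generator `K⁻¹` of `Q`. -/
def Kinv : Q := mk (gen .Kinv)

lemma mk_rel {x y : Free} (h : Rel x y) : mk x = mk y := RingQuot.mkAlgHom_rel ℂ h

lemma K_mul_Kinv : K * Kinv = 1 := by simpa [K, Kinv] using mk_rel Rel.K_Kinv
lemma Kinv_mul_K : Kinv * K = 1 := by simpa [K, Kinv] using mk_rel Rel.Kinv_K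
lemma K_E_Kinv : K * E * Kinv = -E := by simpa [K, Kinv, E] using mk_rel Rel.K_E
lemma K_F_Kinv : K * F * Kinv = -F := by simpa [K, Kinv, F] using mk_rel Rel.K_F
lemma E_F_sub : E * F - F * E = (2 * Complex.I)⁻¹ • (K - Kinv) := by
  have h := mk_rel Rel.E_F
  simp only [map_sub, map_mul, map_smul] at h
  exact h
lemma E_mul_E : E * E = 0 := by simpa [E, sq] using mk_rel Rel.E_sq
lemma F_mul_F : F * F = 0 := by simpa [F, sq] using mk_rel Rel.F_sq
lemma K_pow_four : K ^ 4 = 1 := by simpa [K] using mk_rel Rel.K_four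

lemma K_mul_E : K * E = -(E * K) := by
  have h := congrArg (· * K) K_E_Kinv
  simpa [mul_assoc, Kinv_mul_K] using h
lemma K_mul_F : K * F = -(F * K) := by
  have h := congrArg (· * K) K_F_Kinv
  simpa [mul_assoc, Kinv_mul_K] using h
lemma Kinv_mul_E : Kinv * E = -(E * Kinv) := by
  have h := congrArg (Kinv * ·) K_E_Kinv
  simp only [← mul_assoc, Kinv_mul_K, one_mul] at h
  rw [h]; simp
lemma Kinv_mul_F : Kinv * F = -(F * Kinv) := by
  have h := congrArg (Kinv * ·) K_F_Kinv
  simp only [← mul_assoc, Kinv_mul_K, one_mul] at h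
  rw [h]; simp
lemma F_mul_E : F * E = E * F - (2 * Complex.I)⁻¹ • (K - Kinv) := by
  rw [← E_F_sub]; abel
lemma Kinv_pow_four : Kinv ^ 4 = 1 := by
  have h : (Commute K Kinv) := by rw [Commute, SemiconjBy, K_mul_Kinv, Kinv_mul_K]
  have := h.mul_pow 4
  rwa [K_mul_Kinv, K_pow_four, one_pow, one_mul, eq_comm] at this

/-- The universal property of `Q`: algebra maps out of `Q` are given by the images of the
generators, subject to the defining relations. -/
def lift {A : Type*} [Ring A] [Algebra ℂ A] (f : Gen → A)
    (h : ∀ ⦃x y⦄, Rel x y → FreeAlgebra.lift ℂ f x = FreeAlgebra.lift ℂ f y) : Q →ₐ[ℂ] A :=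
  RingQuot.liftAlgHom ℂ ⟨FreeAlgebra.lift ℂ f, h⟩

lemma lift_mk {A : Type*} [Ring A] [Algebra ℂ A] (f : Gen → A)
    (h : ∀ ⦃x y⦄, Rel x y → FreeAlgebra.lift ℂ f x = FreeAlgebra.lift ℂ f y) (g : Gen) :
    lift f h (mk (gen g)) = f g := by
  unfold lift mk
  erw [RingQuot.liftAlgHom_mkAlgHom_apply]
  simp

lemma hom_ext {A : Type*} [Semiring A] [Algebra ℂ A] {f g : Q →ₐ[ℂ] A}
    (hE : f E = g E) (hF : f F = g F) (hK : f K = g K) (hKinv : f Kinv = g Kinv) : f = g := by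
  have : f.comp mk = g.comp mk := by
    apply FreeAlgebra.hom_ext
    funext x
    cases x
    · exact hE
    · exact hF
    · exact hK
    · exact hKinv
  exact RingQuot.ringQuot_ext' (S := ℂ) f g this

/-- The values of the comultiplication on the generators. -/
def comulGen : Gen → Q ⊗[ℂ] Q
  | .E => 1 ⊗ₜ E + E ⊗ₜ K
  | .F => Kinv ⊗ₜ F + F ⊗ₜ 1
  | .K => K ⊗ₜ K
  | .Kinv => Kinv ⊗ₜ Kinv

lemma comulGen_rel ⦃x y : Free⦄ (h : Rel x y) :
    FreeAlgebra.lift ℂ comulGen x = FreeAlgebra.lift ℂ comulGen y := by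
  induction h with
  | K_Kinv => simp [comulGen, K_mul_Kinv, Algebra.TensorProduct.one_def]
  | Kinv_K => simp [comulGen, Kinv_mul_K, Algebra.TensorProduct.one_def]
  | K_E =>
    simp [comulGen, mul_add, add_mul, K_mul_Kinv, K_E_Kinv, TensorProduct.tmul_neg,
      TensorProduct.neg_tmul, mul_assoc K K Kinv]
    abel
  | K_F =>
    simp [comulGen, mul_add, add_mul, K_mul_Kinv, K_F_Kinv, TensorProduct.tmul_neg,
      TensorProduct.neg_tmul]
    abel
  | E_F =>
    simp only [comulGen, map_sub, map_mul, map_smul, FreeAlgebra.lift_ι_apply, mul_add, add_mul,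
      Algebra.TensorProduct.tmul_mul_tmul, one_mul, mul_one, K_mul_F, Kinv_mul_E, F_mul_E,
      TensorProduct.tmul_neg, TensorProduct.neg_tmul, TensorProduct.tmul_sub,
      TensorProduct.sub_tmul, TensorProduct.tmul_smul, TensorProduct.smul_tmul', smul_sub]
    simp only [← TensorProduct.smul_tmul']
    abel
  | E_sq => simp [comulGen, sq, mul_add, add_mul, E_mul_E, K_mul_E, TensorProduct.tmul_neg]
  | F_sq => simp [comulGen, sq, mul_add, add_mul, F_mul_F, Kinv_mul_F, TensorProduct.neg_tmul]
  | K_four => simp [comulGen, Algebra.TensorProduct.tmul_pow, K_pow_four,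
      Algebra.TensorProduct.one_def]

/-- The comultiplication of `Q`. -/
def comulHom : Q →ₐ[ℂ] Q ⊗[ℂ] Q := lift comulGen comulGen_rel

@[simp] lemma comulHom_E : comulHom E = 1 ⊗ₜ E + E ⊗ₜ K := lift_mk _ comulGen_rel _
@[simp] lemma comulHom_F : comulHom F = Kinv ⊗ₜ F + F ⊗ₜ 1 := lift_mk _ comulGen_rel _
@[simp] lemma comulHom_K : comulHom K = K ⊗ₜ K := lift_mk _ comulGen_rel _
@[simp] lemma comulHom_Kinv : comulHom Kinv = Kinv ⊗ₜ Kinv := lift_mk _ comulGen_rel _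

/-- The values of the counit on the generators. -/
def counitGen : Gen → ℂ
  | .E => 0
  | .F => 0
  | .K => 1
  | .Kinv => 1

lemma counitGen_rel ⦃x y : Free⦄ (h : Rel x y) :
    FreeAlgebra.lift ℂ counitGen x = FreeAlgebra.lift ℂ counitGen y := by
  induction h <;> simp [counitGen]

/-- The counit of `Q`. -/
def counitHom : Q →ₐ[ℂ] ℂ := lift counitGen counitGen_rel

@[simp] lemma counitHom_E : counitHom E = 0 := lift_mk _ counitGen_rel _
@[simp] lemma counitHom_F : counitHom F = 0 := lift_mk _ counitGen_rel _
@[simp] lemma counitHom_K : counitHom K = 1 := lift_mk _ counitGen_rel _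
@[simp] lemma counitHom_Kinv : counitHom Kinv = 1 := lift_mk _ counitGen_rel _

instance : Bialgebra ℂ Q :=
  Bialgebra.ofAlgHom comulHom counitHom
    (by
      apply hom_ext <;>
        simp [TensorProduct.add_tmul, TensorProduct.tmul_add, Algebra.TensorProduct.one_def,
          add_assoc])
    (by apply hom_ext <;> simp)
    (by apply hom_ext <;> simp)

lemma comul_eq (a : Q) : Coalgebra.comul (R := ℂ) a = comulHom a := rfl

lemma counit_eq (a : Q) : Coalgebra.counit (R := ℂ) a = counitHom a := rfl

/-- The values of the antipode on the generators. -/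
def antipodeGen : Gen → Qᵐᵒᵖ
  | .E => .op (-(E * Kinv))
  | .F => .op (-(K * F))
  | .K => .op Kinv
  | .Kinv => .op K

lemma antipodeGen_rel ⦃x y : Free⦄ (h : Rel x y) :
    FreeAlgebra.lift ℂ antipodeGen x = FreeAlgebra.lift ℂ antipodeGen y := by
  apply MulOpposite.unop_injective
  have e3 : ∀ x, K * (E * x) = -(E * (K * x)) := fun x => by
    rw [← mul_assoc, K_mul_E, neg_mul, mul_assoc]
  have e5 : ∀ x, Kinv * (E * x) = -(E * (Kinv * x)) := fun x => by
    rw [← mul_assoc, Kinv_mul_E, neg_mul, mul_assoc]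
  have e7 : ∀ x, E * (E * x) = 0 := fun x => by rw [← mul_assoc, E_mul_E, zero_mul]
  have e8 : ∀ x, F * (F * x) = 0 := fun x => by rw [← mul_assoc, F_mul_F, zero_mul]
  induction h with
  | K_Kinv => simp [antipodeGen, K_mul_Kinv]
  | Kinv_K => simp [antipodeGen, Kinv_mul_K]
  | K_E => simp [antipodeGen, mul_assoc, e3, K_mul_Kinv]
  | K_F => simp [antipodeGen, mul_assoc, K_mul_F, K_mul_Kinv]
  | E_F =>
    simp [antipodeGen, mul_assoc, K_mul_F, K_mul_Kinv, Kinv_mul_K, Kinv_mul_F, F_mul_E, K_mul_E,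
      smul_sub]
    abel
  | E_sq => simp [antipodeGen, sq, mul_assoc, e5, e7]
  | F_sq => simp [antipodeGen, sq, mul_assoc, K_mul_F, e8]
  | K_four => simp [antipodeGen, Kinv_pow_four]

/-- The antipode of `Q`, as an algebra map to the opposite algebra. -/
def antipodeHom : Q →ₐ[ℂ] Qᵐᵒᵖ := lift antipodeGen antipodeGen_rel

@[simp] lemma antipodeHom_E : antipodeHom E = .op (-(E * Kinv)) := lift_mk _ antipodeGen_rel _
@[simp] lemma antipodeHom_F : antipodeHom F = .op (-(K * F)) := lift_mk _ antipodeGen_rel _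
@[simp] lemma antipodeHom_K : antipodeHom K = .op Kinv := lift_mk _ antipodeGen_rel _
@[simp] lemma antipodeHom_Kinv : antipodeHom Kinv = .op K := lift_mk _ antipodeGen_rel _

/-- The antipode of `Q`, as a linear map. -/
def antipodeLin : Q →ₗ[ℂ] Q :=
  (MulOpposite.opLinearEquiv ℂ).symm.toLinearMap ∘ₗ antipodeHom.toLinearMap

lemma antipodeLin_apply (a : Q) : antipodeLin a = (antipodeHom a).unop := rfl

lemma antipodeLin_mul (a b : Q) : antipodeLin (a * b) = antipodeLin b * antipodeLin a := by
  simp [antipodeLin_apply]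

lemma induction_gen {p : Q → Prop} (hc : ∀ c : ℂ, p (algebraMap ℂ Q c))
    (hE : p E) (hF : p F) (hK : p K) (hKinv : p Kinv)
    (hadd : ∀ a b, p a → p b → p (a + b)) (hmul : ∀ a b, p a → p b → p (a * b)) (a : Q) :
    p a := by
  obtain ⟨x, rfl⟩ : ∃ x, mk x = a := RingQuot.mkAlgHom_surjective ℂ Rel a
  induction x using FreeAlgebra.induction with
  | grade0 r => simpa using hc r
  | grade1 g =>
    cases g
    · exact hE
    · exact hF
    · exact hK
    · exact hKinv
  | mul a b ha hb => simpa using hmul _ _ ha hb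
  | add a b ha hb => simpa using hadd _ _ ha hb

lemma antipode_left (a : Q) :
    LinearMap.mul' ℂ Q (antipodeLin.rTensor Q (comulHom a)) = algebraMap ℂ Q (counitHom a) := by
  induction a using induction_gen with
  | hc c => simp [Algebra.algebraMap_eq_smul_one, Algebra.TensorProduct.one_def, antipodeLin_apply]
  | hE => simp [antipodeLin_apply, mul_assoc, Kinv_mul_K]
  | hF => simp [antipodeLin_apply]
  | hK => simp [antipodeLin_apply, Kinv_mul_K]
  | hKinv => simp [antipodeLin_apply, K_mul_Kinv]
  | hadd a b ha hb => simp [ha, hb]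
  | hmul a b ha hb =>
    have key : ∀ x y : Q ⊗[ℂ] Q, LinearMap.mul' ℂ Q (antipodeLin.rTensor Q x) =
        algebraMap ℂ Q (counitHom a) → LinearMap.mul' ℂ Q (antipodeLin.rTensor Q (x * y)) =
          algebraMap ℂ Q (counitHom a) * LinearMap.mul' ℂ Q (antipodeLin.rTensor Q y) := by
      intro x y hx
      induction y with
      | zero => simp
      | add y z hy hz => simp [mul_add, hy, hz]
      | tmul c d =>
        have : ∀ x : Q ⊗[ℂ] Q, LinearMap.mul' ℂ Q (antipodeLin.rTensor Q (x * c ⊗ₜ[ℂ] d)) =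
            antipodeLin c * LinearMap.mul' ℂ Q (antipodeLin.rTensor Q x) * d := by
          intro x
          induction x with
          | zero => simp
          | add x z hx hz => simp [add_mul, mul_add, hx, hz]
          | tmul e f => simp [antipodeLin_mul, mul_assoc]
        rw [this, hx, ← Algebra.commutes, mul_assoc]
        simp
    rw [map_mul, key _ _ ha, hb, map_mul, map_mul]

lemma antipode_right (a : Q) :
    LinearMap.mul' ℂ Q (antipodeLin.lTensor Q (comulHom a)) = algebraMap ℂ Q (counitHom a) := by
  induction a using induction_gen with
  | hc c => simp [Algebra.algebraMap_eq_smul_one, Algebra.TensorProduct.one_def, antipodeLin_apply]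
  | hE => simp [antipodeLin_apply]
  | hF => simp [antipodeLin_apply, ← mul_assoc, Kinv_mul_K]
  | hK => simp [antipodeLin_apply, K_mul_Kinv]
  | hKinv => simp [antipodeLin_apply, Kinv_mul_K]
  | hadd a b ha hb => simp [ha, hb]
  | hmul a b ha hb =>
    have key : ∀ x y : Q ⊗[ℂ] Q, LinearMap.mul' ℂ Q (antipodeLin.lTensor Q y) =
        algebraMap ℂ Q (counitHom b) → LinearMap.mul' ℂ Q (antipodeLin.lTensor Q (x * y)) =
          LinearMap.mul' ℂ Q (antipodeLin.lTensor Q x) * algebraMap ℂ Q (counitHom b) := by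
      intro x y hy
      induction x with
      | zero => simp
      | add x z hx hz => simp [add_mul, hx, hz]
      | tmul c d =>
        have : ∀ y : Q ⊗[ℂ] Q, LinearMap.mul' ℂ Q (antipodeLin.lTensor Q (c ⊗ₜ[ℂ] d * y)) =
            c * LinearMap.mul' ℂ Q (antipodeLin.lTensor Q y) * antipodeLin d := by
          intro y
          induction y with
          | zero => simp
          | add x z hx hz => simp [add_mul, mul_add, hx, hz]
          | tmul e f => simp [antipodeLin_mul, mul_assoc]
        rw [this, hy, mul_assoc, Algebra.commutes, ← mul_assoc]
        simp
    rw [map_mul, key _ _ hb, ha, map_mul, map_mul]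

/-- The Hopf algebra structure of `Q`. -/
instance : HopfAlgebra ℂ Q where
  antipode := antipodeLin
  mul_antipode_rTensor_comul := LinearMap.ext antipode_left
  mul_antipode_lTensor_comul := LinearMap.ext antipode_right

end Q

end RestrictedQuantumGroup

/-! ### Universal R-matrices -/

/-- An element `R` of `H ⊗ H` is a universal R-matrix of the bialgebra `H` if it is invertible,
`R Δ(a) = Δᵒᵖ(a) R` for all `a`, `(Δ ⊗ id)(R) = R₁₃ R₂₃` and `(id ⊗ Δ)(R) = R₁₃ R₁₂`;
the last two equations are written in `H ⊗ (H ⊗ H)`. -/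
structure IsUniversalRMatrix (k : Type*) {H : Type*} [CommRing k] [Ring H] [Bialgebra k H]
    (R : H ⊗[k] H) : Prop where
  isUnit : IsUnit R
  mul_comul : ∀ a : H,
    R * Coalgebra.comul a = TensorProduct.comm k H H (Coalgebra.comul a) * R
  comul_left :
    TensorProduct.assoc k H H H ((Coalgebra.comul (R := k) (A := H)).rTensor H R) =
      Algebra.TensorProduct.map (AlgHom.id k H) Algebra.TensorProduct.includeRight R *
        (1 ⊗ₜ[k] R : H ⊗[k] (H ⊗[k] H))
  comul_right :
    (Coalgebra.comul (R := k) (A := H)).lTensor H R =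
      Algebra.TensorProduct.map (AlgHom.id k H) Algebra.TensorProduct.includeRight R *
        Algebra.TensorProduct.map (AlgHom.id k H) Algebra.TensorProduct.includeLeft R

/-! ### The monoidal category of finite-dimensional representations of a bialgebra -/

/-- A finite-dimensional representation of the `k`-algebra `H`. -/
structure FinDimRep (k H : Type) [Field k] [Ring H] [Algebra k H] where
  /-- The underlying vector space. -/
  V : Type
  [addCommGroup : AddCommGroup V]
  [module : Module k V]
  [finite : FiniteDimensional k V]
  /-- The action of `H`. -/
  ρ : H →ₐ[k] Module.End k V

namespace FinDimRep

attribute [instance] FinDimRep.addCommGroup FinDimRep.module FinDimRep.finite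

section Category

variable {k H : Type} [Field k] [Ring H] [Algebra k H]

/-- Morphisms of representations: linear maps commuting with the action. -/
@[ext]
structure Hom (X Y : FinDimRep k H) where
  /-- The underlying linear map. -/
  hom : X.V →ₗ[k] Y.V
  comm : ∀ h : H, hom ∘ₗ X.ρ h = Y.ρ h ∘ₗ hom

instance : Category (FinDimRep k H) where
  Hom X Y := Hom X Y
  id X := ⟨LinearMap.id, fun _ => rfl⟩
  comp f g := ⟨g.hom ∘ₗ f.hom, fun h => by
    rw [LinearMap.comp_assoc, f.comm, ← LinearMap.comp_assoc, g.comm, LinearMap.comp_assoc]⟩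

@[ext]
lemma hom_ext {X Y : FinDimRep k H} {f g : X ⟶ Y} (h : f.hom = g.hom) : f = g := Hom.ext h

@[simp] lemma id_hom (X : FinDimRep k H) : Hom.hom (𝟙 X) = LinearMap.id := rfl

@[simp] lemma comp_hom {X Y Z : FinDimRep k H} (f : X ⟶ Y) (g : Y ⟶ Z) :
    (f ≫ g).hom = g.hom ∘ₗ f.hom := rfl

/-- An isomorphism of representations from a linear equivalence commuting with the action. -/
def mkIso {X Y : FinDimRep k H} (e : X.V ≃ₗ[k] Y.V)
    (h : ∀ a : H, e.toLinearMap ∘ₗ X.ρ a = Y.ρ a ∘ₗ e.toLinearMap) : X ≅ Y where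
  hom := ⟨e.toLinearMap, h⟩
  inv := ⟨e.symm.toLinearMap, fun a => by
    ext y
    have := LinearMap.congr_fun (h a) (e.symm y)
    simp only [LinearMap.comp_apply, LinearEquiv.coe_coe, LinearEquiv.apply_symm_apply] at this ⊢
    rw [← this, LinearEquiv.symm_apply_apply]⟩
  hom_inv_id := by ext x; simp
  inv_hom_id := by ext x; simp

@[simp] lemma mkIso_hom_hom {X Y : FinDimRep k H} (e : X.V ≃ₗ[k] Y.V)
    (h : ∀ a : H, e.toLinearMap ∘ₗ X.ρ a = Y.ρ a ∘ₗ e.toLinearMap) :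
    (mkIso e h).hom.hom = e.toLinearMap := rfl

@[simp] lemma mkIso_inv_hom {X Y : FinDimRep k H} (e : X.V ≃ₗ[k] Y.V)
    (h : ∀ a : H, e.toLinearMap ∘ₗ X.ρ a = Y.ρ a ∘ₗ e.toLinearMap) :
    (mkIso e h).inv.hom = e.symm.toLinearMap := rfl

/-- The action of `H ⊗ H` on `V ⊗ W`, `(a ⊗ b) . (v ⊗ w) = (a . v) ⊗ (b . w)`. -/
def act₂ {V W : Type} [AddCommGroup V] [Module k V] [AddCommGroup W] [Module k W]
    (ρ : H →ₐ[k] Module.End k V) (σ : H →ₐ[k] Module.End k W) :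
    H ⊗[k] H →ₐ[k] Module.End k (V ⊗[k] W) :=
  (Module.endTensorEndAlgHom (R := k) (S := k) (A := k) (M := V) (N := W)).comp
    (Algebra.TensorProduct.map ρ σ)

@[simp] lemma act₂_tmul {V W : Type} [AddCommGroup V] [Module k V] [AddCommGroup W] [Module k W]
    (ρ : H →ₐ[k] Module.End k V) (σ : H →ₐ[k] Module.End k W) (a b : H) :
    act₂ ρ σ (a ⊗ₜ b) = TensorProduct.map (ρ a) (σ b) := rfl

lemma act₂_natural {X X' Y Y' : FinDimRep k H} (f : Hom X X') (g : Hom Y Y') (z : H ⊗[k] H) :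
    TensorProduct.map f.hom g.hom ∘ₗ act₂ X.ρ Y.ρ z =
      act₂ X'.ρ Y'.ρ z ∘ₗ TensorProduct.map f.hom g.hom := by
  induction z with
  | zero => simp
  | add x y hx hy => simp only [map_add, LinearMap.comp_add, LinearMap.add_comp, hx, hy]
  | tmul a b => simp only [act₂_tmul, ← TensorProduct.map_comp, f.comm, g.comm]

end Category

section Monoidal

variable {k H : Type} [Field k] [Ring H] [Bialgebra k H]

section Actions

variable {V W U : Type} [AddCommGroup V] [Module k V] [AddCommGroup W] [Module k W]
  [AddCommGroup U] [Module k U]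

/-- The action of `H` on `V ⊗ W` through the comultiplication. -/
def tensorAct (ρ : H →ₐ[k] Module.End k V) (σ : H →ₐ[k] Module.End k W) :
    H →ₐ[k] Module.End k (V ⊗[k] W) :=
  (act₂ ρ σ).comp (Bialgebra.comulAlgHom k H)

variable (k H) in
/-- The action of `H` on `k` through the counit. -/
def trivAct : H →ₐ[k] Module.End k k :=
  (Algebra.lmul k k).comp (Bialgebra.counitAlgHom k H)

lemma tensorAct_apply (ρ : H →ₐ[k] Module.End k V) (σ : H →ₐ[k] Module.End k W) (a : H) :
    tensorAct ρ σ a = act₂ ρ σ (Coalgebra.comul a) := rfl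

/-- The action of `H ⊗ (H ⊗ H)` on `V ⊗ (W ⊗ U)`. -/
def act₃ (ρ : H →ₐ[k] Module.End k V) (σ : H →ₐ[k] Module.End k W)
    (τ : H →ₐ[k] Module.End k U) : H ⊗[k] (H ⊗[k] H) →ₐ[k] Module.End k (V ⊗[k] (W ⊗[k] U)) :=
  (Module.endTensorEndAlgHom (R := k) (S := k) (A := k) (M := V) (N := W ⊗[k] U)).comp
    (Algebra.TensorProduct.map ρ (act₂ σ τ))

lemma assoc_act₂ (ρ : H →ₐ[k] Module.End k V) (σ : H →ₐ[k] Module.End k W)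
    (τ : H →ₐ[k] Module.End k U) (z : H ⊗[k] H) :
    (TensorProduct.assoc k V W U).toLinearMap ∘ₗ act₂ (tensorAct ρ σ) τ z =
      act₃ ρ σ τ (TensorProduct.assoc k H H H
        ((Coalgebra.comul (R := k) (A := H)).rTensor H z)) ∘ₗ
      (TensorProduct.assoc k V W U).toLinearMap := by
  induction z with
  | zero => simp
  | add x y hx hy => simp only [map_add, LinearMap.comp_add, LinearMap.add_comp, hx, hy]
  | tmul a b =>
    rw [act₂_tmul, tensorAct_apply, LinearMap.rTensor_tmul]
    generalize (Coalgebra.comul (R := k) a : H ⊗[k] H) = w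
    induction w with
    | zero => simp
    | add x y hx hy =>
      simp only [map_add, LinearMap.comp_add, LinearMap.add_comp, TensorProduct.add_tmul,
        TensorProduct.map_add_left, hx, hy]
    | tmul c d => exact TensorProduct.ext_threefold fun x y z => rfl

lemma act₃_lTensor_comul (ρ : H →ₐ[k] Module.End k V) (σ : H →ₐ[k] Module.End k W)
    (τ : H →ₐ[k] Module.End k U) (z : H ⊗[k] H) :
    act₃ ρ σ τ ((Coalgebra.comul (R := k) (A := H)).lTensor H z) =
      act₂ ρ (tensorAct σ τ) z := by
  induction z with
  | zero => simp
  | add x y hx hy => simp only [map_add, hx, hy]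
  | tmul a b => rfl

lemma assoc_tensorAct (ρ : H →ₐ[k] Module.End k V) (σ : H →ₐ[k] Module.End k W)
    (τ : H →ₐ[k] Module.End k U) (a : H) :
    (TensorProduct.assoc k V W U).toLinearMap ∘ₗ tensorAct (tensorAct ρ σ) τ a =
      tensorAct ρ (tensorAct σ τ) a ∘ₗ (TensorProduct.assoc k V W U).toLinearMap := by
  rw [tensorAct_apply, assoc_act₂, Coalgebra.coassoc_apply, act₃_lTensor_comul, tensorAct_apply]

lemma lid_act₂ (ρ : H →ₐ[k] Module.End k V) (z : H ⊗[k] H) :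
    (TensorProduct.lid k V).toLinearMap ∘ₗ act₂ (trivAct k H) ρ z =
      ρ (TensorProduct.lid k H ((Coalgebra.counit (R := k) (A := H)).rTensor H z)) ∘ₗ
        (TensorProduct.lid k V).toLinearMap := by
  induction z with
  | zero => simp
  | add x y hx hy => simp only [map_add, LinearMap.comp_add, LinearMap.add_comp, hx, hy]
  | tmul a b => exact TensorProduct.ext' fun c x => by simp [trivAct, mul_smul]

lemma rid_act₂ (ρ : H →ₐ[k] Module.End k V) (z : H ⊗[k] H) :
    (TensorProduct.rid k V).toLinearMap ∘ₗ act₂ ρ (trivAct k H) z =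
      ρ (TensorProduct.rid k H ((Coalgebra.counit (R := k) (A := H)).lTensor H z)) ∘ₗ
        (TensorProduct.rid k V).toLinearMap := by
  induction z with
  | zero => simp
  | add x y hx hy => simp only [map_add, LinearMap.comp_add, LinearMap.add_comp, hx, hy]
  | tmul a b => exact TensorProduct.ext' fun x c => by simp [trivAct, mul_smul]

lemma lid_tensorAct (ρ : H →ₐ[k] Module.End k V) (a : H) :
    (TensorProduct.lid k V).toLinearMap ∘ₗ tensorAct (trivAct k H) ρ a =
      ρ a ∘ₗ (TensorProduct.lid k V).toLinearMap := by
  rw [tensorAct_apply, lid_act₂, Coalgebra.rTensor_counit_comul, TensorProduct.lid_tmul, one_smul]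

lemma rid_tensorAct (ρ : H →ₐ[k] Module.End k V) (a : H) :
    (TensorProduct.rid k V).toLinearMap ∘ₗ tensorAct ρ (trivAct k H) a =
      ρ a ∘ₗ (TensorProduct.rid k V).toLinearMap := by
  rw [tensorAct_apply, rid_act₂, Coalgebra.lTensor_counit_comul, TensorProduct.rid_tmul, one_smul]

end Actions

/-- The tensor product of representations, with `H` acting through the comultiplication. -/
def tensor (X Y : FinDimRep k H) : FinDimRep k H where
  V := X.V ⊗[k] Y.V
  ρ := tensorAct X.ρ Y.ρ

/-- The trivial representation, with `H` acting on `k` through the counit. -/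
def triv : FinDimRep k H where
  V := k
  ρ := trivAct k H

/-- The tensor product of morphisms. -/
def tensorMap {X X' Y Y' : FinDimRep k H} (f : Hom X X') (g : Hom Y Y') :
    Hom (tensor X Y) (tensor X' Y') where
  hom := TensorProduct.map f.hom g.hom
  comm _ := act₂_natural f g _

/-- The associator, which is that of vector spaces. -/
def assocIso (X Y Z : FinDimRep k H) : tensor (tensor X Y) Z ≅ tensor X (tensor Y Z) :=
  mkIso (X := tensor (tensor X Y) Z) (Y := tensor X (tensor Y Z))
    (TensorProduct.assoc k X.V Y.V Z.V) (assoc_tensorAct X.ρ Y.ρ Z.ρ)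

/-- The left unitor, which is that of vector spaces. -/
def lidIso (X : FinDimRep k H) : tensor triv X ≅ X :=
  mkIso (X := tensor triv X) (TensorProduct.lid k X.V) (lid_tensorAct X.ρ)

/-- The right unitor, which is that of vector spaces. -/
def ridIso (X : FinDimRep k H) : tensor X triv ≅ X :=
  mkIso (X := tensor X triv) (TensorProduct.rid k X.V) (rid_tensorAct X.ρ)

/-- The monoidal category of finite-dimensional representations of the bialgebra `H`. -/
instance : MonoidalCategory (FinDimRep k H) where
  tensorObj := tensor
  tensorUnit := triv
  tensorHom f g := tensorMap f g
  whiskerLeft X _ _ f := tensorMap (𝟙 X) f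
  whiskerRight f Y := tensorMap f (𝟙 Y)
  associator := assocIso
  leftUnitor := lidIso
  rightUnitor := ridIso
  tensorHom_def f g := by
    apply hom_ext
    exact TensorProduct.ext' fun _ _ => rfl
  id_tensorHom_id X Y := by
    apply hom_ext
    exact TensorProduct.ext' fun _ _ => rfl
  tensorHom_comp_tensorHom f₁ f₂ g₁ g₂ := by
    apply hom_ext
    exact TensorProduct.ext' fun _ _ => rfl
  whiskerLeft_id X Y := by
    apply hom_ext
    exact TensorProduct.ext' fun _ _ => rfl
  id_whiskerRight X Y := by
    apply hom_ext
    exact TensorProduct.ext' fun _ _ => rfl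
  associator_naturality f₁ f₂ f₃ := by
    apply hom_ext
    exact TensorProduct.ext_threefold fun _ _ _ => rfl
  leftUnitor_naturality {X Y} f := by
    apply hom_ext
    exact TensorProduct.ext' fun (c : k) x => (map_smul f.hom c x).symm
  rightUnitor_naturality f := by
    apply hom_ext
    exact TensorProduct.ext' fun x (c : k) => (map_smul f.hom c x).symm
  pentagon W X Y Z := by
    apply hom_ext
    exact TensorProduct.ext_fourfold fun _ _ _ _ => rfl
  triangle X Y := by
    apply hom_ext
    exact TensorProduct.ext_threefold fun x (c : k) y => (TensorProduct.smul_tmul c x y).symm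

end Monoidal

end FinDimRep

end

/-!
The ordered monomials `E ^ a * F ^ b * K ^ c` span `Q`, and they are separated by the modules
induced from the four characters of `K`, together with a Vandermonde argument in the powers of `K`.

Braiding with the one-dimensional representation `χ : E, F ↦ 0, K ↦ -1` yields for every
representation a linear automorphism `G`, multiplicative on tensor products and equal to the
identity on invariant vectors. Since `χ ^ 2` is the counit, `G ^ 2 = 1`, and since `χ` twists
`Δ` on its two sides differently, `G` anticommutes with `E` and `F`. Hence on the two-dimensional
simple module `G` is `diag(-t, t)` with `t ^ 2 = 1`, and it multiplies the invariant vector of the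
tensor square by `-t ^ 2 = -1`, which is absurd. A universal R-matrix would produce a braiding.

Commutativity of the tensor product up to isomorphism only needs some invertible intertwiner between
`Δ` and `Δᵒᵖ`, with no hexagon identities. The central involution `K ^ 2` splits each
representation into an even and an odd part, and explicit intertwiners exist for each pair of parts.
-/

noncomputable section

lemma pow_mul_pow_of_anticommute {A : Type*} [Ring A] {x y : A} (h : x * y = -(y * x))
    (m n : ℕ) : x ^ m * y ^ n = (-1 : ℤ) ^ (m * n) • (y ^ n * x ^ m) := by
  have hm : SemiconjBy y (x ^ m) ((-x) ^ m) := SemiconjBy.pow_right (by simp [SemiconjBy, h]) m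
  have hn : SemiconjBy (x ^ m) y ((-1 : ℤ) ^ m • y) := by
    rw [SemiconjBy, smul_mul_assoc, hm.eq]
    rcases m.even_or_odd with hm | hm <;> simp [hm.neg_pow]
  rw [(hn.pow_right n).eq, smul_pow, smul_mul_assoc, pow_mul]

namespace RestrictedQuantumGroup

open Complex (I)

namespace Q

lemma Kinv_eq : Kinv = K ^ 3 := by
  calc Kinv = Kinv * (K * K ^ 3) := by rw [← pow_succ', K_pow_four, mul_one]
    _ = K ^ 3 := by rw [← mul_assoc, Kinv_mul_K, one_mul]

/-- Images of the generators `E`, `F`, `K` under an algebra map from `Q` to `A`: elements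
satisfying the defining relations of `Q`, with `K⁻¹` eliminated in favour of `K ^ 3`. -/
structure GeneratorImages (A : Type*) [Ring A] [Algebra ℂ A] where
  /-- The image of `E`. -/
  e : A
  /-- The image of `F`. -/
  f : A
  /-- The image of `K`. -/
  k : A
  k_pow_four : k ^ 4 = 1
  k_mul_e : k * e = -(e * k)
  k_mul_f : k * f = -(f * k)
  e_f_sub : e * f - f * e = (2 * I)⁻¹ • (k - k ^ 3)
  e_mul_e : e * e = 0
  f_mul_f : f * f = 0

namespace GeneratorImages

variable {A : Type*} [Ring A] [Algebra ℂ A] (g : GeneratorImages A)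

/-- The values of `GeneratorImages.toAlgHom` on the generators. -/
def toFun : Gen → A
  | .E => g.e
  | .F => g.f
  | .K => g.k
  | .Kinv => g.k ^ 3

lemma toFun_rel ⦃x y : Free⦄ (h : Rel x y) :
    FreeAlgebra.lift ℂ g.toFun x = FreeAlgebra.lift ℂ g.toFun y := by
  have k_mul_k_pow : g.k * g.k ^ 3 = 1 := by rw [← pow_succ', g.k_pow_four]
  induction h with
  | K_Kinv => simpa [toFun] using k_mul_k_pow
  | Kinv_K => simpa [toFun, ← pow_succ] using g.k_pow_four
  | K_E =>
    simp only [map_mul, map_neg, FreeAlgebra.lift_ι_apply, toFun]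
    rw [g.k_mul_e, neg_mul, mul_assoc, k_mul_k_pow, mul_one]
  | K_F =>
    simp only [map_mul, map_neg, FreeAlgebra.lift_ι_apply, toFun]
    rw [g.k_mul_f, neg_mul, mul_assoc, k_mul_k_pow, mul_one]
  | E_F => simpa only [map_sub, map_mul, map_smul, FreeAlgebra.lift_ι_apply, toFun] using g.e_f_sub
  | E_sq => simpa [toFun, sq] using g.e_mul_e
  | F_sq => simpa [toFun, sq] using g.f_mul_f
  | K_four => simpa [toFun] using g.k_pow_four

/-- The algebra map out of `Q` with the given values on the generators. -/
def toAlgHom : Q →ₐ[ℂ] A := lift g.toFun g.toFun_rel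

@[simp] lemma toAlgHom_E : g.toAlgHom E = g.e := lift_mk _ g.toFun_rel _
@[simp] lemma toAlgHom_F : g.toAlgHom F = g.f := lift_mk _ g.toFun_rel _
@[simp] lemma toAlgHom_K : g.toAlgHom K = g.k := lift_mk _ g.toFun_rel _

end GeneratorImages

/-! ### The basis of ordered monomials -/

/-- The ordered monomial `E ^ a * F ^ b * K ^ c`. -/
def monomial (j : (Fin 2 × Fin 2) × Fin 4) : Q :=
  E ^ (j.1.1 : ℕ) * F ^ (j.1.2 : ℕ) * K ^ (j.2 : ℕ)

lemma E_pow_mul_F_pow_mul_K_pow_mem_span (a b c : ℕ) :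
    E ^ a * F ^ b * K ^ c ∈ Submodule.span ℂ (Set.range monomial) := by
  have pow_eq_zero {x : Q} (hx : x * x = 0) {n : ℕ} (hn : 2 ≤ n) : x ^ n = 0 :=
    pow_eq_zero_of_le hn (by rw [sq, hx])
  by_cases ha : a < 2
  · by_cases hb : b < 2
    · rw [show K ^ c = K ^ (c % 4) from pow_eq_pow_mod c K_pow_four]
      exact Submodule.subset_span ⟨((⟨a, ha⟩, ⟨b, hb⟩), ⟨c % 4, Nat.mod_lt _ (by norm_num)⟩), rfl⟩
    · simp [pow_eq_zero F_mul_F (not_lt.mp hb)]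
  · simp [pow_eq_zero E_mul_E (not_lt.mp ha)]

lemma mul_mem_span_monomial {z : Q}
    (hz : ∀ a b c : ℕ, z * (E ^ a * F ^ b * K ^ c) ∈ Submodule.span ℂ (Set.range monomial)) :
    ∀ x ∈ Submodule.span ℂ (Set.range monomial),
      z * x ∈ Submodule.span ℂ (Set.range monomial) := by
  suffices Submodule.span ℂ (Set.range monomial) ≤
      (Submodule.span ℂ (Set.range monomial)).comap (LinearMap.mulLeft ℂ z) from this
  rw [Submodule.span_le]
  rintro _ ⟨⟨⟨a, b⟩, c⟩, rfl⟩
  exact hz a b c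

lemma K_mul_monomial (a b c : ℕ) : K * (E ^ a * F ^ b * K ^ c) =
    (-1 : ℤ) ^ (a + b) • (E ^ a * F ^ b * K ^ (c + 1)) := by
  have hE := pow_mul_pow_of_anticommute K_mul_E 1 a
  have hF := pow_mul_pow_of_anticommute K_mul_F 1 b
  rw [pow_one, one_mul] at hE hF
  rw [← mul_assoc, ← mul_assoc, hE, smul_mul_assoc, mul_assoc (E ^ a), hF, pow_add, mul_smul,
    pow_succ' K c]
  simp only [mul_smul_comm, smul_mul_assoc, mul_assoc]

lemma F_mul_E_mul_monomial (b c : ℕ) : F * (E * F ^ b * K ^ c) =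
    E * F ^ (b + 1) * K ^ c - (2 * I)⁻¹ •
      ((-1 : ℤ) ^ b • (F ^ b * K ^ (c + 1)) - (-1 : ℤ) ^ (3 * b) • (F ^ b * K ^ (3 + c))) := by
  have hK := pow_mul_pow_of_anticommute K_mul_F 1 b
  rw [pow_one, one_mul] at hK
  rw [← mul_assoc, ← mul_assoc, F_mul_E, Kinv_eq, sub_mul, sub_mul, smul_mul_assoc, sub_mul, hK,
    pow_mul_pow_of_anticommute K_mul_F, smul_mul_assoc, sub_mul, pow_succ' F, pow_succ' K c,
    pow_add K 3]
  simp only [smul_mul_assoc, mul_assoc]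

lemma eq_top_of_generator_mul_mem {S : Submodule ℂ Q} (one_mem : 1 ∈ S)
    (hE : ∀ x ∈ S, E * x ∈ S) (hF : ∀ x ∈ S, F * x ∈ S) (hK : ∀ x ∈ S, K * x ∈ S) : S = ⊤ := by
  have mul_mem (a : Q) : ∀ x ∈ S, a * x ∈ S := by
    induction a using induction_gen with
    | hc c => intro x hx; rw [← Algebra.smul_def]; exact S.smul_mem c hx
    | hE => exact hE
    | hF => exact hF
    | hK => exact hK
    | hKinv =>
      intro x hx
      rw [Kinv_eq, pow_succ, pow_two, mul_assoc, mul_assoc]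
      exact hK _ (hK _ (hK _ hx))
    | hadd a b ha hb => intro x hx; rw [add_mul]; exact S.add_mem (ha x hx) (hb x hx)
    | hmul a b ha hb => intro x hx; rw [mul_assoc]; exact ha _ (hb x hx)
  exact (Submodule.eq_top_iff').mpr fun a => by simpa using mul_mem a 1 one_mem

lemma span_monomial : Submodule.span ℂ (Set.range monomial) = ⊤ := by
  have mem := E_pow_mul_F_pow_mul_K_pow_mem_span
  refine eq_top_of_generator_mul_mem (by simpa using mem 0 0 0) (mul_mem_span_monomial ?_)
    (mul_mem_span_monomial ?_) (mul_mem_span_monomial ?_)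
  · intro a b c
    simpa only [pow_succ', mul_assoc] using mem (a + 1) b c
  · intro a b c
    match a with
    | 0 => simpa only [pow_zero, one_mul, pow_succ', mul_assoc] using mem 0 (b + 1) c
    | 1 =>
      have mem_zero (n : ℕ) := by simpa only [pow_zero, one_mul] using mem 0 b n
      rw [pow_one, F_mul_E_mul_monomial]
      refine sub_mem (by simpa only [pow_one] using mem 1 (b + 1) c) (Submodule.smul_mem _ _ ?_)
      exact sub_mem (zsmul_mem (mem_zero _) _) (zsmul_mem (mem_zero _) _)
    | a + 2 => simp [pow_add, sq, E_mul_E]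
  · intro a b c
    rw [K_mul_monomial]
    exact zsmul_mem (mem a b (c + 1)) _

/-- The module induced from the character `K ↦ κ` of the subalgebra generated by `K`, in the
basis `v, F v, E v, E F v`. -/
def inducedModule (κ : ℂ) (hκ : κ ^ 4 = 1) : GeneratorImages (Matrix (Fin 4) (Fin 4) ℂ) where
  e := !![0, 0, 0, 0; 0, 0, 0, 0; 1, 0, 0, 0; 0, 1, 0, 0]
  f := !![0, 0, -((2 * I)⁻¹ * (κ - κ ^ 3)), 0; 1, 0, 0, (2 * I)⁻¹ * (κ - κ ^ 3);
    0, 0, 0, 0; 0, 0, 1, 0]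
  k := Matrix.diagonal ![κ, -κ, -κ, κ]
  k_pow_four := by
    rw [Matrix.diagonal_pow, ← Matrix.diagonal_one]
    congr 1
    ext i
    fin_cases i <;> simp [hκ, Even.neg_pow (show Even 4 by decide)]
  k_mul_e := by ext i j; fin_cases i <;> fin_cases j <;> simp [Matrix.vecMul_diagonal]
  k_mul_f := by ext i j; fin_cases i <;> fin_cases j <;> simp [Matrix.vecMul_diagonal, mul_comm]
  e_f_sub := by
    rw [Matrix.diagonal_pow]
    ext i j
    fin_cases i <;> fin_cases j <;> simp [Odd.neg_pow (show Odd 3 by decide)] <;> ring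
  e_mul_e := by ext i j; fin_cases i <;> fin_cases j <;> simp [Matrix.mul_apply, Fin.sum_univ_four]
  f_mul_f := by ext i j; fin_cases i <;> fin_cases j <;> simp [Matrix.mul_apply, Fin.sum_univ_four]

/-- The action of `Q` on the generator `v` of the induced module with parameter `κ`. -/
def inducedEval (κ : ℂ) (hκ : κ ^ 4 = 1) : Q →ₗ[ℂ] Fin 4 → ℂ :=
  (Matrix.mulVecBilin ℂ ℂ).flip (Pi.single 0 1) ∘ₗ (inducedModule κ hκ).toAlgHom.toLinearMap

lemma inducedEval_monomial (κ : ℂ) (hκ : κ ^ 4 = 1) (j : (Fin 2 × Fin 2) × Fin 4) :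
    inducedEval κ hκ (monomial j) = Pi.single (finProdFinEquiv j.1) (κ ^ (j.2 : ℕ)) := by
  obtain ⟨⟨a, b⟩, c⟩ := j
  simp only [inducedEval, monomial, LinearMap.comp_apply, LinearMap.flip_apply,
    AlgHom.toLinearMap_apply, Matrix.mulVecBilin_apply, map_mul, map_pow,
    GeneratorImages.toAlgHom_E, GeneratorImages.toAlgHom_F, GeneratorImages.toAlgHom_K,
    inducedModule, Matrix.diagonal_pow]
  ext i
  fin_cases a <;> fin_cases b <;> fin_cases i <;> simp [finProdFinEquiv, Matrix.vecMul_diagonal]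

lemma injective_I_pow : Function.Injective fun j : Fin 4 => I ^ (j : ℕ) := by
  intro i j h
  fin_cases i <;> fin_cases j <;> first | rfl | (norm_num [Complex.ext_iff, pow_succ] at h)

lemma linearIndependent_monomial : LinearIndependent ℂ monomial := by
  rw [Fintype.linearIndependent_iff]
  rintro x hx ⟨⟨a, b⟩, c⟩
  have vandermonde (j : Fin 4) : ∑ c : Fin 4, (I ^ (j : ℕ)) ^ (c : ℕ) * x ((a, b), c) = 0 := by
    have hj : (I ^ (j : ℕ)) ^ 4 = 1 := by
      rw [← pow_mul, mul_comm, pow_mul, Complex.I_pow_four, one_pow]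
    have h := congrFun (congrArg (inducedEval _ hj) hx) (finProdFinEquiv (a, b))
    simp only [map_sum, map_smul, inducedEval_monomial, Finset.sum_apply, Pi.smul_apply,
      smul_eq_mul, map_zero, Pi.zero_apply, Pi.single_apply,
      finProdFinEquiv.injective.eq_iff] at h
    rw [Fintype.sum_prod_type] at h
    simpa [mul_comm] using h
  exact congrFun (Matrix.eq_zero_of_forall_index_sum_pow_mul_eq_zero injective_I_pow vandermonde) c

/-- The Poincaré–Birkhoff–Witt basis of `Q`. -/
def monomialBasis : Module.Basis ((Fin 2 × Fin 2) × Fin 4) ℂ Q :=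
  .mk linearIndependent_monomial span_monomial.ge

theorem finrank_eq : Module.finrank ℂ Q = 16 := by
  simp [Module.finrank_eq_card_basis monomialBasis]

end Q

end RestrictedQuantumGroup

/-! ### Braiding with a character -/

namespace FinDimRep

section Winding

variable {k H V : Type} [Field k] [Ring H] [Bialgebra k H] [AddCommGroup V] [Module k V]

/-- The action of `H` on `k` through a character. -/
def characterAct (χ : WithConv (H →ₐ[k] k)) : H →ₐ[k] Module.End k k :=
  (Algebra.lmul k k).comp χ.ofConv

/-- The left winding endomorphism `a ↦ χ(a₁) a₂` of a character `χ`. -/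
def leftWinding (χ : WithConv (H →ₐ[k] k)) : H →ₐ[k] H :=
  ((Algebra.TensorProduct.lid k H).toAlgHom.comp
    (Algebra.TensorProduct.map χ.ofConv (AlgHom.id k H))).comp (Bialgebra.comulAlgHom k H)

/-- The right winding endomorphism `a ↦ a₁ χ(a₂)` of a character `χ`. -/
def rightWinding (χ : WithConv (H →ₐ[k] k)) : H →ₐ[k] H :=
  ((Algebra.TensorProduct.rid k k H).toAlgHom.comp
    (Algebra.TensorProduct.map (AlgHom.id k H) χ.ofConv)).comp (Bialgebra.comulAlgHom k H)

lemma tensorAct_characterAct_left (χ : WithConv (H →ₐ[k] k)) (ρ : H →ₐ[k] Module.End k V) (a : H)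
    (v : V) : tensorAct (characterAct χ) ρ a (1 ⊗ₜ[k] v) = 1 ⊗ₜ[k] ρ (leftWinding χ a) v := by
  simp only [tensorAct_apply, leftWinding, AlgHom.comp_apply, Bialgebra.comulAlgHom_apply]
  induction (Coalgebra.comul (R := k) a : H ⊗[k] H) with
  | zero => simp
  | add x y hx hy => simp only [map_add, LinearMap.add_apply, TensorProduct.tmul_add, hx, hy]
  | tmul b c => simp [characterAct, TensorProduct.smul_tmul']

lemma tensorAct_characterAct_right (χ : WithConv (H →ₐ[k] k)) (ρ : H →ₐ[k] Module.End k V) (a : H)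
    (v : V) : tensorAct ρ (characterAct χ) a (v ⊗ₜ[k] 1) = ρ (rightWinding χ a) v ⊗ₜ[k] 1 := by
  simp only [tensorAct_apply, rightWinding, AlgHom.comp_apply, Bialgebra.comulAlgHom_apply]
  induction (Coalgebra.comul (R := k) a : H ⊗[k] H) with
  | zero => simp
  | add x y hx hy => simp only [map_add, LinearMap.add_apply, TensorProduct.add_tmul, hx, hy]
  | tmul b c => simp [characterAct, TensorProduct.smul_tmul]

lemma mul'_comp_tensorAct_characterAct (χ ψ : WithConv (H →ₐ[k] k)) (a : H) :
    LinearMap.mul' k k ∘ₗ tensorAct (characterAct χ) (characterAct ψ) a =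
      characterAct (χ * ψ) a ∘ₗ LinearMap.mul' k k := by
  simp only [tensorAct_apply, characterAct, AlgHom.convMul_def, AlgHom.comp_apply,
    Bialgebra.comulAlgHom_apply]
  induction (Coalgebra.comul (R := k) a : H ⊗[k] H) with
  | zero => simp
  | add x y hx hy => simp only [map_add, LinearMap.comp_add, LinearMap.add_comp, hx, hy]
  | tmul b c => ext; simp

end Winding

section Braiding

variable {k H : Type} [Field k] [Ring H] [Bialgebra k H] [BraidedCategory (FinDimRep k H)]
  {V W U : Type} [AddCommGroup V] [Module k V] [FiniteDimensional k V]
  [AddCommGroup W] [Module k W] [FiniteDimensional k W]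
  [AddCommGroup U] [Module k U] [FiniteDimensional k U]

/-- The linear map underlying a braiding. -/
def braidMap (ρ : H →ₐ[k] Module.End k V) (σ : H →ₐ[k] Module.End k W) :
    V ⊗[k] W →ₗ[k] W ⊗[k] V :=
  (β_ (⟨V, ρ⟩ : FinDimRep k H) ⟨W, σ⟩).hom.hom

lemma braidMap_tensorAct (ρ : H →ₐ[k] Module.End k V) (σ : H →ₐ[k] Module.End k W) (a : H)
    (z : V ⊗[k] W) :
    braidMap ρ σ (tensorAct ρ σ a z) = tensorAct σ ρ a (braidMap ρ σ z) :=
  LinearMap.congr_fun ((β_ (⟨V, ρ⟩ : FinDimRep k H) ⟨W, σ⟩).hom.comm a) z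

lemma braidMap_naturality_left {ρ : H →ₐ[k] Module.End k V} {σ : H →ₐ[k] Module.End k W}
    (f : V →ₗ[k] W) (hf : ∀ a, f ∘ₗ ρ a = σ a ∘ₗ f) (τ : H →ₐ[k] Module.End k U) (v : V) (u : U) :
    braidMap σ τ (f v ⊗ₜ u) = TensorProduct.map LinearMap.id f (braidMap ρ τ (v ⊗ₜ u)) :=
  let φ : (⟨V, ρ⟩ : FinDimRep k H) ⟶ ⟨W, σ⟩ := ⟨f, hf⟩
  LinearMap.congr_fun (congrArg Hom.hom (BraidedCategory.braiding_naturality_left φ ⟨U, τ⟩))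
    (v ⊗ₜ u)

lemma braidMap_naturality_right {ρ : H →ₐ[k] Module.End k V} {σ : H →ₐ[k] Module.End k W}
    (f : V →ₗ[k] W) (hf : ∀ a, f ∘ₗ ρ a = σ a ∘ₗ f) (τ : H →ₐ[k] Module.End k U) (u : U) (v : V) :
    braidMap τ σ (u ⊗ₜ f v) = TensorProduct.map f LinearMap.id (braidMap τ ρ (u ⊗ₜ v)) :=
  let φ : (⟨V, ρ⟩ : FinDimRep k H) ⟶ ⟨W, σ⟩ := ⟨f, hf⟩
  LinearMap.congr_fun (congrArg Hom.hom (BraidedCategory.braiding_naturality_right ⟨U, τ⟩ φ))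
    (u ⊗ₜ v)

lemma braidMap_hexagon_forward (ρ : H →ₐ[k] Module.End k V) (σ : H →ₐ[k] Module.End k W)
    (τ : H →ₐ[k] Module.End k U) (v : V) (w : W) (u : U) :
    TensorProduct.assoc k W U V (braidMap ρ (tensorAct σ τ) (v ⊗ₜ (w ⊗ₜ u))) =
      TensorProduct.map LinearMap.id (braidMap ρ τ)
        (TensorProduct.assoc k W V U (braidMap ρ σ (v ⊗ₜ w) ⊗ₜ u)) :=
  LinearMap.congr_fun (congrArg Hom.hom
    (BraidedCategory.hexagon_forward (⟨V, ρ⟩ : FinDimRep k H) ⟨W, σ⟩ ⟨U, τ⟩)) ((v ⊗ₜ w) ⊗ₜ u)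

lemma braidMap_hexagon_reverse (ρ : H →ₐ[k] Module.End k V) (σ : H →ₐ[k] Module.End k W)
    (τ : H →ₐ[k] Module.End k U) (v : V) (w : W) (u : U) :
    (TensorProduct.assoc k U V W).symm (braidMap (tensorAct ρ σ) τ ((v ⊗ₜ w) ⊗ₜ u)) =
      TensorProduct.map (braidMap ρ τ) LinearMap.id
        ((TensorProduct.assoc k V U W).symm (v ⊗ₜ braidMap σ τ (w ⊗ₜ u))) :=
  LinearMap.congr_fun (congrArg Hom.hom
    (BraidedCategory.hexagon_reverse (⟨V, ρ⟩ : FinDimRep k H) ⟨W, σ⟩ ⟨U, τ⟩)) (v ⊗ₜ (w ⊗ₜ u))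

lemma rid_braidMap_trivAct (ρ : H →ₐ[k] Module.End k V) (v : V) :
    TensorProduct.rid k V (braidMap (trivAct k H) ρ (1 ⊗ₜ[k] v)) = v :=
  (LinearMap.congr_fun (congrArg Hom.hom (braiding_rightUnitor (⟨V, ρ⟩ : FinDimRep k H)))
    ((1 : k) ⊗ₜ[k] v)).trans (by exact one_smul k v)

lemma lid_braidMap_trivAct (ρ : H →ₐ[k] Module.End k V) (v : V) :
    TensorProduct.lid k V (braidMap ρ (trivAct k H) (v ⊗ₜ[k] 1)) = v :=
  (LinearMap.congr_fun (congrArg Hom.hom (braiding_leftUnitor (⟨V, ρ⟩ : FinDimRep k H)))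
    (v ⊗ₜ[k] (1 : k))).trans (by exact one_smul k v)

/-- The endomorphism of the vector space `V` of a representation obtained by braiding with a
character, `k ⊗ V → V ⊗ k`. -/
def braidCharacter (χ : WithConv (H →ₐ[k] k)) (ρ : H →ₐ[k] Module.End k V) : Module.End k V :=
  (TensorProduct.rid k V).toLinearMap ∘ₗ braidMap (characterAct χ) ρ ∘ₗ TensorProduct.mk k k V 1

lemma braidMap_characterAct (χ : WithConv (H →ₐ[k] k)) (ρ : H →ₐ[k] Module.End k V) (v : V) :
    braidMap (characterAct χ) ρ (1 ⊗ₜ[k] v) = braidCharacter χ ρ v ⊗ₜ[k] 1 :=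
  ((TensorProduct.rid k V).symm_apply_apply _).symm

lemma braidCharacter_mul_leftWinding (χ : WithConv (H →ₐ[k] k)) (ρ : H →ₐ[k] Module.End k V)
    (a : H) : braidCharacter χ ρ * ρ (leftWinding χ a) =
      ρ (rightWinding χ a) * braidCharacter χ ρ := by
  ext v
  have h := braidMap_tensorAct (characterAct χ) ρ a (1 ⊗ₜ[k] v)
  rw [tensorAct_characterAct_left, braidMap_characterAct, braidMap_characterAct,
    tensorAct_characterAct_right] at h
  simpa using congrArg (TensorProduct.rid k V) h

lemma braidCharacter_tensorAct (χ : WithConv (H →ₐ[k] k)) (ρ : H →ₐ[k] Module.End k V)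
    (σ : H →ₐ[k] Module.End k W) :
    braidCharacter χ (tensorAct ρ σ) =
      TensorProduct.map (braidCharacter χ ρ) (braidCharacter χ σ) := by
  refine TensorProduct.ext' fun v w => ?_
  have h := braidMap_hexagon_forward (characterAct χ) ρ σ 1 v w
  rw [braidMap_characterAct, braidMap_characterAct, TensorProduct.assoc_tmul,
    TensorProduct.map_tmul, LinearMap.id_apply, braidMap_characterAct,
    ← TensorProduct.assoc_tmul] at h
  simpa using congrArg (TensorProduct.rid k (V ⊗[k] W))
    ((TensorProduct.assoc k V W k).injective h)

lemma braidCharacter_one (ρ : H →ₐ[k] Module.End k V) : braidCharacter 1 ρ = 1 :=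
  LinearMap.ext fun v => rid_braidMap_trivAct ρ v

lemma braidCharacter_mul (χ ψ : WithConv (H →ₐ[k] k)) (ρ : H →ₐ[k] Module.End k V) :
    braidCharacter (χ * ψ) ρ = braidCharacter χ ρ * braidCharacter ψ ρ := by
  ext v
  have hexagon := braidMap_hexagon_reverse (characterAct χ) (characterAct ψ) ρ 1 1 v
  rw [braidMap_characterAct, TensorProduct.assoc_symm_tmul, TensorProduct.map_tmul,
    braidMap_characterAct, LinearMap.id_apply, LinearEquiv.symm_apply_eq,
    TensorProduct.assoc_tmul] at hexagon
  have naturality := braidMap_naturality_left (LinearMap.mul' k k)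
    (mul'_comp_tensorAct_characterAct χ ψ) ρ (1 ⊗ₜ 1) v
  rw [hexagon, LinearMap.mul'_apply, mul_one, braidMap_characterAct] at naturality
  simpa using congrArg (TensorProduct.rid k V) naturality

lemma braidCharacter_apply_of_invariant (χ : WithConv (H →ₐ[k] k)) (ρ : H →ₐ[k] Module.End k V)
    {v : V} (hv : ∀ a : H, ρ a v = Coalgebra.counit (R := k) a • v) :
    braidCharacter χ ρ v = v := by
  have equivariant (a : H) : LinearMap.toSpanSingleton k V v ∘ₗ trivAct k H a =
      ρ a ∘ₗ LinearMap.toSpanSingleton k V v := by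
    ext
    simp [trivAct, hv]
  have braid_one : braidMap (characterAct χ) (trivAct k H) (1 ⊗ₜ[k] 1) = 1 ⊗ₜ[k] 1 :=
    (TensorProduct.lid k k).injective (by simpa using lid_braidMap_trivAct (characterAct χ) 1)
  have h := braidMap_naturality_right _ equivariant (characterAct χ) 1 1
  rw [braid_one, TensorProduct.map_tmul, LinearMap.toSpanSingleton_apply_one,
    braidMap_characterAct] at h
  simpa using congrArg (TensorProduct.rid k V) h

end Braiding

end FinDimRep

/-! ### Braidings from intertwiners -/

namespace FinDimRep

section Intertwiner

variable {k H : Type} [Field k] [Ring H]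

section Actions

variable [Algebra k H] {V W : Type} [AddCommGroup V] [Module k V] [AddCommGroup W] [Module k W]

lemma comm_comp_act₂_comm (ρ : H →ₐ[k] Module.End k V) (σ : H →ₐ[k] Module.End k W)
    (z : H ⊗[k] H) :
    (TensorProduct.comm k V W).toLinearMap ∘ₗ act₂ ρ σ (TensorProduct.comm k H H z) =
      act₂ σ ρ z ∘ₗ (TensorProduct.comm k V W).toLinearMap := by
  induction z with
  | zero => simp
  | add x y hx hy => simp only [map_add, LinearMap.comp_add, LinearMap.add_comp, hx, hy]
  | tmul a b => exact TensorProduct.ext' fun v w => rfl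

lemma comm_comp_act₂_natural {X X' Y Y' : FinDimRep k H} (f : X ⟶ X') (g : Y ⟶ Y')
    (z : H ⊗[k] H) :
    ((TensorProduct.comm k X'.V Y'.V).toLinearMap ∘ₗ act₂ X'.ρ Y'.ρ z) ∘ₗ
        TensorProduct.map f.hom g.hom =
      TensorProduct.map g.hom f.hom ∘ₗ
        (TensorProduct.comm k X.V Y.V).toLinearMap ∘ₗ act₂ X.ρ Y.ρ z := by
  have comm_map : (TensorProduct.comm k X'.V Y'.V).toLinearMap ∘ₗ TensorProduct.map f.hom g.hom =
      TensorProduct.map g.hom f.hom ∘ₗ (TensorProduct.comm k X.V Y.V).toLinearMap :=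
    TensorProduct.ext' fun _ _ => rfl
  rw [LinearMap.comp_assoc, ← act₂_natural f g, ← LinearMap.comp_assoc, comm_map,
    LinearMap.comp_assoc]

end Actions

variable [Bialgebra k H]

/-- An intertwiner between the actions of `Δ(a)` and `Δᵒᵖ(a)` on `X ⊗ Y`, followed by the flip. -/
def flipIso (X Y : FinDimRep k H) (r : (Module.End k (X.V ⊗[k] Y.V))ˣ)
    (hr : ∀ a : H, SemiconjBy (r : Module.End k (X.V ⊗[k] Y.V))
      (act₂ X.ρ Y.ρ (Coalgebra.comul a))
      (act₂ X.ρ Y.ρ (TensorProduct.comm k H H (Coalgebra.comul a)))) :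
    X ⊗ Y ≅ Y ⊗ X :=
  mkIso (X := tensor X Y) (Y := tensor Y X)
    (LinearMap.GeneralLinearGroup.toLinearEquiv r ≪≫ₗ TensorProduct.comm k X.V Y.V) fun a => by
      change ((TensorProduct.comm k X.V Y.V).toLinearMap ∘ₗ r.val) ∘ₗ _ =
        act₂ Y.ρ X.ρ (Coalgebra.comul a) ∘ₗ (TensorProduct.comm k X.V Y.V).toLinearMap ∘ₗ r.val
      rw [← LinearMap.comp_assoc, ← comm_comp_act₂_comm, LinearMap.comp_assoc]
      exact congrArg ((TensorProduct.comm k X.V Y.V).toLinearMap ∘ₗ ·) (hr a)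

end Intertwiner

section Legs

variable {k H : Type} [Field k] [Ring H] [Bialgebra k H] {V W U : Type} [AddCommGroup V]
  [Module k V] [AddCommGroup W] [Module k W] [AddCommGroup U] [Module k U]
  (ρ : H →ₐ[k] Module.End k V) (σ : H →ₐ[k] Module.End k W) (τ : H →ₐ[k] Module.End k U)

lemma act₃_one_tmul (z : H ⊗[k] H) :
    act₃ ρ σ τ (1 ⊗ₜ[k] z) = TensorProduct.map LinearMap.id (act₂ σ τ z) := by
  change TensorProduct.map (ρ 1) (act₂ σ τ z) = _
  rw [map_one]
  rfl

lemma act₃_map_includeLeft_comp_assoc (z : H ⊗[k] H) :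
    act₃ ρ σ τ (Algebra.TensorProduct.map (AlgHom.id k H) Algebra.TensorProduct.includeLeft z) ∘ₗ
        (TensorProduct.assoc k V W U).toLinearMap =
      (TensorProduct.assoc k V W U).toLinearMap ∘ₗ
        TensorProduct.map (act₂ ρ σ z) LinearMap.id := by
  induction z with
  | zero => simp
  | add x y hx hy =>
    simp only [map_add, LinearMap.add_comp, LinearMap.comp_add, TensorProduct.map_add_left, hx, hy]
  | tmul a b =>
    refine TensorProduct.ext_threefold fun v w u => ?_
    change ρ a v ⊗ₜ (σ b w ⊗ₜ τ 1 u) = ρ a v ⊗ₜ (σ b w ⊗ₜ u)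
    rw [map_one, Module.End.one_apply]

lemma comm_comp_act₃_map_includeRight (z : H ⊗[k] H) :
    (TensorProduct.assoc k W U V).toLinearMap ∘ₗ
        (TensorProduct.comm k V (W ⊗[k] U)).toLinearMap ∘ₗ
        act₃ ρ σ τ
          (Algebra.TensorProduct.map (AlgHom.id k H) Algebra.TensorProduct.includeRight z) ∘ₗ
        (TensorProduct.assoc k V W U).toLinearMap =
      TensorProduct.map LinearMap.id
          ((TensorProduct.comm k V U).toLinearMap ∘ₗ act₂ ρ τ z) ∘ₗ
        (TensorProduct.assoc k W V U).toLinearMap ∘ₗ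
        TensorProduct.map (TensorProduct.comm k V W).toLinearMap LinearMap.id := by
  induction z with
  | zero => simp
  | add x y hx hy =>
    simp only [map_add, LinearMap.add_comp, LinearMap.comp_add, TensorProduct.map_add_right, hx, hy]
  | tmul a b =>
    refine TensorProduct.ext_threefold fun v w u => ?_
    change σ 1 w ⊗ₜ (τ b u ⊗ₜ ρ a v) = w ⊗ₜ (τ b u ⊗ₜ ρ a v)
    rw [map_one, Module.End.one_apply]

lemma comm_comp_assoc_symm_comp_act₃_map_includeRight (z : H ⊗[k] H) :
    (TensorProduct.assoc k U V W).symm.toLinearMap ∘ₗ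
        (TensorProduct.comm k (V ⊗[k] W) U).toLinearMap ∘ₗ
        (TensorProduct.assoc k V W U).symm.toLinearMap ∘ₗ
        act₃ ρ σ τ
          (Algebra.TensorProduct.map (AlgHom.id k H) Algebra.TensorProduct.includeRight z) =
      TensorProduct.map ((TensorProduct.comm k V U).toLinearMap ∘ₗ act₂ ρ τ z) LinearMap.id ∘ₗ
        (TensorProduct.assoc k V U W).symm.toLinearMap ∘ₗ
        TensorProduct.map LinearMap.id (TensorProduct.comm k W U).toLinearMap := by
  induction z with
  | zero => simp
  | add x y hx hy =>
    simp only [map_add, LinearMap.add_comp, LinearMap.comp_add, TensorProduct.map_add_left, hx, hy]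
  | tmul a b =>
    refine TensorProduct.ext <| LinearMap.ext fun v => TensorProduct.ext' fun w u => ?_
    change (τ b u ⊗ₜ ρ a v) ⊗ₜ σ 1 w = (τ b u ⊗ₜ ρ a v) ⊗ₜ w
    rw [map_one, Module.End.one_apply]

end Legs

end FinDimRep

namespace IsUniversalRMatrix

open FinDimRep

variable {k H : Type} [Field k] [Ring H] [Bialgebra k H] {R : H ⊗[k] H}

/-- The braiding isomorphism `v ⊗ w ↦ flip (R (v ⊗ w))` of a universal R-matrix `R`. -/
def braidingIso (hR : IsUniversalRMatrix k R) (X Y : FinDimRep k H) : X ⊗ Y ≅ Y ⊗ X :=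
  flipIso X Y (Units.map (act₂ X.ρ Y.ρ).toMonoidHom hR.isUnit.unit) fun a =>
    SemiconjBy.map (f := act₂ X.ρ Y.ρ) (hR.mul_comul a)

section Hexagons

variable {V W U : Type} [AddCommGroup V] [Module k V] [AddCommGroup W] [Module k W]
  [AddCommGroup U] [Module k U] (ρ : H →ₐ[k] Module.End k V) (σ : H →ₐ[k] Module.End k W)
  (τ : H →ₐ[k] Module.End k U)

lemma hexagon_forward (hR : IsUniversalRMatrix k R) :
    (TensorProduct.assoc k W U V).toLinearMap ∘ₗ
        ((TensorProduct.comm k V (W ⊗[k] U)).toLinearMap ∘ₗ act₂ ρ (tensorAct σ τ) R) ∘ₗ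
        (TensorProduct.assoc k V W U).toLinearMap =
      (TensorProduct.map LinearMap.id ((TensorProduct.comm k V U).toLinearMap ∘ₗ act₂ ρ τ R) ∘ₗ
        (TensorProduct.assoc k W V U).toLinearMap) ∘ₗ
        TensorProduct.map ((TensorProduct.comm k V W).toLinearMap ∘ₗ act₂ ρ σ R) LinearMap.id := by
  have h := congrArg (· ∘ₗ TensorProduct.map (act₂ ρ σ R) LinearMap.id)
    (comm_comp_act₃_map_includeRight ρ σ τ R)
  simp only [LinearMap.comp_assoc, ← act₃_map_includeLeft_comp_assoc ρ σ τ R,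
    ← TensorProduct.map_comp, LinearMap.comp_id] at h
  rw [← act₃_lTensor_comul, hR.comul_right, map_mul, Module.End.mul_eq_comp]
  simpa only [LinearMap.comp_assoc] using h

lemma hexagon_reverse (hR : IsUniversalRMatrix k R) :
    (TensorProduct.assoc k U V W).symm.toLinearMap ∘ₗ
        ((TensorProduct.comm k (V ⊗[k] W) U).toLinearMap ∘ₗ act₂ (tensorAct ρ σ) τ R) ∘ₗ
        (TensorProduct.assoc k V W U).symm.toLinearMap =
      (TensorProduct.map ((TensorProduct.comm k V U).toLinearMap ∘ₗ act₂ ρ τ R) LinearMap.id ∘ₗ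
        (TensorProduct.assoc k V U W).symm.toLinearMap) ∘ₗ
        TensorProduct.map LinearMap.id ((TensorProduct.comm k W U).toLinearMap ∘ₗ act₂ σ τ R) := by
  have conj : act₂ (tensorAct ρ σ) τ R ∘ₗ (TensorProduct.assoc k V W U).symm.toLinearMap =
      (TensorProduct.assoc k V W U).symm.toLinearMap ∘ₗ
        act₃ ρ σ τ
          (Algebra.TensorProduct.map (AlgHom.id k H) Algebra.TensorProduct.includeRight R) ∘ₗ
        TensorProduct.map LinearMap.id (act₂ σ τ R) := by
    rw [LinearEquiv.eq_toLinearMap_symm_comp, ← LinearMap.comp_assoc,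
      LinearEquiv.comp_toLinearMap_symm_eq, assoc_act₂, hR.comul_left, map_mul, act₃_one_tmul,
      Module.End.mul_eq_comp]
  have h := congrArg (· ∘ₗ TensorProduct.map LinearMap.id (act₂ σ τ R))
    (comm_comp_assoc_symm_comp_act₃_map_includeRight ρ σ τ R)
  simp only [LinearMap.comp_assoc, ← TensorProduct.map_comp, LinearMap.comp_id] at h
  simp only [LinearMap.comp_assoc, conj]
  exact h

end Hexagons

/-- The braided structure on representations defined by a universal R-matrix. -/
abbrev braidedCategory (hR : IsUniversalRMatrix k R) : BraidedCategory (FinDimRep k H) where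
  braiding := hR.braidingIso
  braiding_naturality_right X _ _ f := FinDimRep.hom_ext (comm_comp_act₂_natural (𝟙 X) f R)
  braiding_naturality_left f Z := FinDimRep.hom_ext (comm_comp_act₂_natural f (𝟙 Z) R)
  hexagon_forward X Y Z := FinDimRep.hom_ext (hR.hexagon_forward X.ρ Y.ρ Z.ρ)
  hexagon_reverse X Y Z := FinDimRep.hom_ext (hR.hexagon_reverse X.ρ Y.ρ Z.ρ)

end IsUniversalRMatrix

/-! ### Non-existence of a braiding -/

namespace RestrictedQuantumGroup

open Complex (I)

namespace Q

lemma apply_eq_counit_smul_of_generators {V : Type} [AddCommGroup V] [Module ℂ V]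
    (ρ : Q →ₐ[ℂ] Module.End ℂ V) {v : V} (hE : ρ E v = 0) (hF : ρ F v = 0) (hK : ρ K v = v)
    (a : Q) : ρ a v = Coalgebra.counit (R := ℂ) a • v := by
  induction a using induction_gen with
  | hc c => simp
  | hE => simp [counit_eq, hE]
  | hF => simp [counit_eq, hF]
  | hK => simp [counit_eq, hK]
  | hKinv => simp [counit_eq, Kinv_eq, pow_succ, hK]
  | hadd a b ha hb => rw [map_add, map_add, LinearMap.add_apply, ha, hb, add_smul]
  | hmul a b ha hb =>
    rw [map_mul, Module.End.mul_apply, hb, map_smul, ha, Bialgebra.counit_mul, smul_smul, mul_comm]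

/-- The character `E, F ↦ 0`, `K ↦ -1`, of order two in the group of characters. -/
def signCharacter : WithConv (Q →ₐ[ℂ] ℂ) :=
  .toConv (GeneratorImages.toAlgHom
    { e := 0, f := 0, k := -1
      k_pow_four := by norm_num
      k_mul_e := by simp
      k_mul_f := by simp
      e_f_sub := by norm_num
      e_mul_e := by simp
      f_mul_f := by simp })

@[simp] lemma signCharacter_E : signCharacter.ofConv E = 0 := GeneratorImages.toAlgHom_E _

@[simp] lemma signCharacter_F : signCharacter.ofConv F = 0 := GeneratorImages.toAlgHom_F _

@[simp] lemma signCharacter_K : signCharacter.ofConv K = -1 := GeneratorImages.toAlgHom_K _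

@[simp] lemma signCharacter_Kinv : signCharacter.ofConv Kinv = -1 := by
  rw [Kinv_eq, map_pow, signCharacter_K]
  norm_num

lemma signCharacter_mul_self : signCharacter * signCharacter = 1 := by
  refine WithConv.ofConv_injective ?_
  rw [AlgHom.convMul_def]
  refine hom_ext ?_ ?_ ?_ ?_ <;> simp [comul_eq, counit_eq, AlgHom.convOne_def]

section BraidSign

variable [BraidedCategory (FinDimRep ℂ Q)] {V : Type} [AddCommGroup V] [Module ℂ V]
  [FiniteDimensional ℂ V] (ρ : Q →ₐ[ℂ] Module.End ℂ V)

open FinDimRep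

lemma braidCharacter_sign_mul_self :
    braidCharacter signCharacter ρ * braidCharacter signCharacter ρ = 1 := by
  rw [← braidCharacter_mul, signCharacter_mul_self, braidCharacter_one]

lemma braidCharacter_sign_mul_E :
    braidCharacter signCharacter ρ * ρ E = -(ρ E * braidCharacter signCharacter ρ) := by
  simpa [leftWinding, rightWinding, comul_eq] using
    braidCharacter_mul_leftWinding signCharacter ρ E

lemma braidCharacter_sign_mul_F :
    braidCharacter signCharacter ρ * ρ F = -(ρ F * braidCharacter signCharacter ρ) := by
  simpa [leftWinding, rightWinding, comul_eq, neg_eq_iff_eq_neg] using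
    braidCharacter_mul_leftWinding signCharacter ρ F

end BraidSign

/-- The generators of `Q` acting on its two-dimensional simple module of highest weight `i`. -/
def simpleModule : GeneratorImages (Matrix (Fin 2) (Fin 2) ℂ) where
  e := !![0, 1; 0, 0]
  f := !![0, 0; 1, 0]
  k := !![I, 0; 0, -I]
  k_pow_four := by simp [pow_succ, Matrix.one_fin_two]
  k_mul_e := by simp
  k_mul_f := by simp
  e_f_sub := by
    ext i j
    fin_cases i <;> fin_cases j <;> simp [pow_succ] <;> field_simp <;> norm_num
  e_mul_e := by simp [← Matrix.ext_iff, Fin.forall_fin_two]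
  f_mul_f := by simp [← Matrix.ext_iff, Fin.forall_fin_two]

/-- The two-dimensional simple representation of `Q` of highest weight `i`. -/
def simpleRep : Q →ₐ[ℂ] Module.End ℂ (Fin 2 → ℂ) :=
  Matrix.toLinAlgEquiv'.toAlgHom.comp simpleModule.toAlgHom

/-- The vector of weight `i` in the simple module. -/
def highestVector : Fin 2 → ℂ := ![1, 0]

/-- The vector of weight `-i` in the simple module. -/
def lowestVector : Fin 2 → ℂ := ![0, 1]

@[simp] lemma highestVector_zero : highestVector 0 = 1 := rfl

@[simp] lemma highestVector_one : highestVector 1 = 0 := rfl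

@[simp] lemma lowestVector_zero : lowestVector 0 = 0 := rfl

@[simp] lemma lowestVector_one : lowestVector 1 = 1 := rfl

lemma simpleRep_E (v : Fin 2 → ℂ) : simpleRep E v = v 1 • highestVector := by
  ext i
  fin_cases i <;> simp [simpleRep, simpleModule, highestVector, Matrix.vecHead, Matrix.vecTail]

lemma simpleRep_F (v : Fin 2 → ℂ) : simpleRep F v = v 0 • lowestVector := by
  ext i
  fin_cases i <;> simp [simpleRep, simpleModule, lowestVector, Matrix.vecHead]

lemma simpleRep_K_highestVector : simpleRep K highestVector = I • highestVector := by
  ext i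
  fin_cases i <;> simp [simpleRep, simpleModule, highestVector]

lemma simpleRep_K_lowestVector : simpleRep K lowestVector = -I • lowestVector := by
  ext i
  fin_cases i <;> simp [simpleRep, simpleModule, lowestVector]

lemma simpleRep_Kinv_lowestVector : simpleRep Kinv lowestVector = I • lowestVector := by
  have h : simpleRep Kinv (simpleRep K lowestVector) = lowestVector := by
    rw [← Module.End.mul_apply, ← map_mul, Kinv_mul_K, map_one, Module.End.one_apply]
  rw [simpleRep_K_lowestVector, map_smul] at h
  conv_rhs => rw [← h, smul_smul]
  simp

/-- The vector spanning the trivial submodule of the tensor square of the simple module. -/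
def pairingVector : (Fin 2 → ℂ) ⊗[ℂ] (Fin 2 → ℂ) :=
  lowestVector ⊗ₜ highestVector - I • highestVector ⊗ₜ lowestVector

lemma pairingVector_ne_zero : pairingVector ≠ 0 := by
  intro h
  have := congrArg (LinearMap.mul' ℂ ℂ ∘ₗ
    TensorProduct.map (LinearMap.proj (1 : Fin 2)) (LinearMap.proj (0 : Fin 2))) h
  simp [pairingVector] at this

lemma tensorAct_pairingVector (a : Q) :
    FinDimRep.tensorAct simpleRep simpleRep a pairingVector =
      Coalgebra.counit (R := ℂ) a • pairingVector := by
  refine apply_eq_counit_smul_of_generators _ ?_ ?_ ?_ a <;>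
    simp [FinDimRep.tensorAct_apply, comul_eq, pairingVector, simpleRep_E, simpleRep_F,
      simpleRep_K_highestVector, simpleRep_K_lowestVector, simpleRep_Kinv_lowestVector, smul_smul,
      ← TensorProduct.smul_tmul', TensorProduct.neg_tmul, TensorProduct.tmul_neg]

lemma map_pairingVector_eq_neg {G : Module.End ℂ (Fin 2 → ℂ)}
    (hE : G * simpleRep E = -(simpleRep E * G)) (hF : G * simpleRep F = -(simpleRep F * G))
    (hG : G * G = 1) : TensorProduct.map G G pairingVector = -pairingVector := by
  set t := G lowestVector 1
  have high : G highestVector = -t • highestVector := by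
    simpa [simpleRep_E, t] using LinearMap.congr_fun hE lowestVector
  have low : G lowestVector = t • lowestVector := by
    simpa [simpleRep_F, high] using LinearMap.congr_fun hF highestVector
  have t_mul_t : t * t = 1 := by
    simpa [low] using congrFun (LinearMap.congr_fun hG lowestVector) 1
  simp only [pairingVector, map_sub, map_smul, TensorProduct.map_tmul, high, low,
    TensorProduct.smul_tmul_smul, mul_neg, neg_mul, t_mul_t]
  module

theorem isEmpty_braidedCategory : IsEmpty (BraidedCategory (FinDimRep ℂ Q)) := by
  have : IsAddTorsionFree ((Fin 2 → ℂ) ⊗[ℂ] (Fin 2 → ℂ)) := .of_isTorsionFree ℂ _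
  refine ⟨fun _ => pairingVector_ne_zero (self_eq_neg.mp ?_)⟩
  calc pairingVector
    _ = FinDimRep.braidCharacter signCharacter (FinDimRep.tensorAct simpleRep simpleRep)
          pairingVector :=
      (FinDimRep.braidCharacter_apply_of_invariant _ _ tensorAct_pairingVector).symm
    _ = -pairingVector := by
      rw [FinDimRep.braidCharacter_tensorAct]
      exact map_pairingVector_eq_neg (braidCharacter_sign_mul_E _) (braidCharacter_sign_mul_F _)
        (braidCharacter_sign_mul_self _)

theorem not_exists_isUniversalRMatrix : ¬ ∃ R : Q ⊗[ℂ] Q, IsUniversalRMatrix ℂ R :=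
  fun ⟨_, hR⟩ => isEmpty_braidedCategory.false hR.braidedCategory

end Q

end RestrictedQuantumGroup

/-! ### Intertwiners between the comultiplication and its opposite -/

namespace RestrictedQuantumGroup

open Complex (I I_mul_I)

namespace Q

namespace GeneratorImages

section Parity

variable {A : Type*} [Ring A] [Algebra ℂ A] (g : GeneratorImages A)

/-- `K ^ 2` acts as the scalar `s`; since `K ^ 4 = 1` only `s = 1` (the even case) and `s = -1`
(the odd case) matter. -/
def HasParity (s : ℂ) : Prop := g.k * g.k = s • 1

variable {g} {s : ℂ}

lemma HasParity.k_pow_three (hg : g.HasParity s) : g.k ^ 3 = s • g.k := by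
  rw [pow_succ', sq, show g.k * g.k = s • 1 from hg, mul_smul_comm, mul_one]

lemma HasParity.f_mul_e (hg : g.HasParity s) :
    g.f * g.e = g.e * g.f + (I * (1 - s) / 2) • g.k := by
  have h : g.f * g.e = g.e * g.f - (2 * I)⁻¹ • (g.k - g.k ^ 3) := by rw [← g.e_f_sub]; abel
  rw [h, hg.k_pow_three, mul_inv, Complex.inv_I]
  module

/-- The rewriting rules towards linear combinations of the ordered monomials in `e`, `f`, `k`. -/
lemma HasParity.ordering_rules (hg : g.HasParity s) :
    (g.k * g.k = s • 1 ∧ g.k * g.e = -(g.e * g.k) ∧ g.k * g.f = -(g.f * g.k) ∧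
      g.f * g.e = g.e * g.f + (I * (1 - s) / 2) • g.k ∧ g.e * g.e = 0 ∧ g.f * g.f = 0) ∧
    (∀ x, g.k * (g.k * x) = s • x) ∧ (∀ x, g.k * (g.e * x) = -(g.e * (g.k * x))) ∧
    (∀ x, g.k * (g.f * x) = -(g.f * (g.k * x))) ∧
    (∀ x, g.f * (g.e * x) = g.e * (g.f * x) + (I * (1 - s) / 2) • (g.k * x)) ∧
    (∀ x, g.e * (g.e * x) = 0) ∧ ∀ x, g.f * (g.f * x) = 0 := by
  have k_mul_k : g.k * g.k = s • 1 := hg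
  refine ⟨⟨k_mul_k, g.k_mul_e, g.k_mul_f, hg.f_mul_e, g.e_mul_e, g.f_mul_f⟩, ?_⟩
  simp only [← mul_assoc, k_mul_k, g.k_mul_e, g.k_mul_f, hg.f_mul_e, g.e_mul_e, g.f_mul_f, neg_mul,
    smul_mul_assoc, one_mul, add_mul, zero_mul, implies_true, and_self]

end Parity

section Intertwiners

variable {A B : Type*} [Ring A] [Algebra ℂ A] [Ring B] [Algebra ℂ B] (g : GeneratorImages A)
  (h : GeneratorImages B)

lemma tmul_rules :
    (∀ (a a' : A) (b b' : B), a ⊗ₜ[ℂ] b * a' ⊗ₜ[ℂ] b' = (a * a') ⊗ₜ (b * b')) ∧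
      (∀ (a : A) (b b' : B), a ⊗ₜ[ℂ] (b + b') = a ⊗ₜ b + a ⊗ₜ b') ∧
      (∀ (a a' : A) (b : B), (a + a') ⊗ₜ[ℂ] b = a ⊗ₜ b + a' ⊗ₜ b) ∧
      (∀ (a a' : A) (b : B), (a - a') ⊗ₜ[ℂ] b = a ⊗ₜ b - a' ⊗ₜ b) ∧
      (∀ (a : A) (b : B), (-a) ⊗ₜ[ℂ] b = -(a ⊗ₜ b)) ∧
      (∀ (a : A) (b : B), a ⊗ₜ[ℂ] (-b) = -(a ⊗ₜ b)) ∧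
      (∀ a : A, a ⊗ₜ[ℂ] (0 : B) = 0) ∧ (∀ b : B, (0 : A) ⊗ₜ[ℂ] b = 0) ∧
      (∀ (c : ℂ) (a : A) (b : B), a ⊗ₜ[ℂ] (c • b) = c • a ⊗ₜ b) ∧
      ∀ (c : ℂ) (a : A) (b : B), (c • a) ⊗ₜ[ℂ] b = c • a ⊗ₜ b :=
  ⟨fun _ _ _ _ => Algebra.TensorProduct.tmul_mul_tmul .., TensorProduct.tmul_add,
    TensorProduct.add_tmul, TensorProduct.sub_tmul, TensorProduct.neg_tmul, TensorProduct.tmul_neg,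
    TensorProduct.tmul_zero _, TensorProduct.zero_tmul _,
    fun c a b => TensorProduct.tmul_smul c a b, fun _ _ _ => rfl⟩

/-- An element of `A ⊗ B` intertwining the images of `Δ(a)` and `Δᵒᵖ(a)` under a pair of algebra
maps from `Q` to `A` and to `B`, for each generator `a`. -/
structure IsIntertwiner (r : A ⊗[ℂ] B) : Prop where
  semiconjBy_e : SemiconjBy r (1 ⊗ₜ h.e + g.e ⊗ₜ h.k) (g.e ⊗ₜ 1 + g.k ⊗ₜ h.e)
  semiconjBy_f : SemiconjBy r ((g.k ^ 3) ⊗ₜ h.f + g.f ⊗ₜ 1) (g.f ⊗ₜ (h.k ^ 3) + 1 ⊗ₜ h.f)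
  semiconjBy_k : SemiconjBy r (g.k ⊗ₜ h.k) (g.k ⊗ₜ h.k)

variable {g h}

lemma exists_isIntertwiner_even_even (hg : g.HasParity 1) (hh : h.HasParity 1) :
    ∃ r : A ⊗[ℂ] B, IsUnit r ∧ g.IsIntertwiner h r := by
  -- `-1` on the common `-1`-eigenspace of `k ⊗ 1` and `1 ⊗ k`, and `1` on the other three.
  obtain ⟨r, hr⟩ : ∃ r : A ⊗[ℂ] B,
    r = (2⁻¹ : ℂ) • (1 ⊗ₜ 1 + g.k ⊗ₜ 1 + 1 ⊗ₜ h.k - g.k ⊗ₜ h.k) := ⟨_, rfl⟩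
  refine ⟨r, .of_pow_eq_one (n := 2) ?_ two_ne_zero, ?_, ?_, ?_⟩ <;>
    simp only [SemiconjBy, hr, sq, hg.k_pow_three, hh.k_pow_three, Algebra.TensorProduct.one_def,
      mul_add, add_mul, sub_mul, mul_sub, smul_mul_assoc, mul_smul_comm, tmul_rules,
      hg.ordering_rules, hh.ordering_rules, one_mul, mul_one] <;>
    match_scalars <;> ring

lemma exists_diagonal_semiconjBy (hg : g.HasParity 1) (hh : h.HasParity (-1)) :
    ∃ r : A ⊗[ℂ] B, IsUnit r ∧
      SemiconjBy r (1 ⊗ₜ h.e + g.e ⊗ₜ h.k) (g.k ⊗ₜ h.e - I • g.e ⊗ₜ 1) ∧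
      SemiconjBy r ((g.k ^ 3) ⊗ₜ h.f + g.f ⊗ₜ 1) (1 ⊗ₜ h.f + I • g.f ⊗ₜ h.k) ∧
      SemiconjBy r (g.k ⊗ₜ h.k) (g.k ⊗ₜ h.k) := by
  -- `1` on the `1`-eigenspace of `k ⊗ 1` and `I • 1 ⊗ k` on the `-1`-eigenspace.
  obtain ⟨r, hr⟩ : ∃ r : A ⊗[ℂ] B,
    r = (2⁻¹ : ℂ) • ((1 + g.k) ⊗ₜ 1 + I • (1 - g.k) ⊗ₜ h.k) := ⟨_, rfl⟩
  refine ⟨r, .of_pow_eq_one (n := 2) ?_ two_ne_zero, ?_, ?_, ?_⟩ <;>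
    simp only [SemiconjBy, hr, sq, hg.k_pow_three, Algebra.TensorProduct.one_def,
      mul_add, add_mul, sub_mul, mul_sub, smul_mul_assoc, mul_smul_comm, tmul_rules,
      hg.ordering_rules, hh.ordering_rules, one_mul, mul_one] <;>
    match_scalars <;> grind [I_mul_I]

lemma exists_unipotent_f_e_semiconjBy (hg : g.HasParity 1) (hh : h.HasParity (-1)) :
    ∃ r : A ⊗[ℂ] B, IsUnit r ∧
      SemiconjBy r (g.k ⊗ₜ h.e - I • g.e ⊗ₜ 1) (g.k ⊗ₜ h.e - I • g.e ⊗ₜ 1) ∧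
      SemiconjBy r (1 ⊗ₜ h.f + I • g.f ⊗ₜ h.k) (g.f ⊗ₜ (h.k ^ 3) + 1 ⊗ₜ h.f) ∧
      SemiconjBy r (g.k ⊗ₜ h.k) (g.k ⊗ₜ h.k) := by
  obtain ⟨n, hn⟩ : ∃ n : A ⊗[ℂ] B, n = (1 - I) • g.f ⊗ₜ h.e := ⟨_, rfl⟩
  have n_sq : n ^ 2 = 0 := by simp [hn, sq, h.e_mul_e]
  refine ⟨1 + n, IsNilpotent.isUnit_one_add ⟨2, n_sq⟩, ?_, ?_, ?_⟩ <;>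
    simp only [SemiconjBy, hn, hh.k_pow_three,
      mul_add, add_mul, sub_mul, mul_sub, smul_mul_assoc, mul_smul_comm, tmul_rules,
      hg.ordering_rules, hh.ordering_rules, one_mul, mul_one] <;>
    match_scalars <;> grind [I_mul_I]

lemma exists_unipotent_e_f_semiconjBy (hg : g.HasParity 1) (hh : h.HasParity (-1)) :
    ∃ r : A ⊗[ℂ] B, IsUnit r ∧
      SemiconjBy r (g.k ⊗ₜ h.e - I • g.e ⊗ₜ 1) (g.e ⊗ₜ 1 + g.k ⊗ₜ h.e) ∧
      SemiconjBy r (g.f ⊗ₜ (h.k ^ 3) + 1 ⊗ₜ h.f) (g.f ⊗ₜ (h.k ^ 3) + 1 ⊗ₜ h.f) ∧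
      SemiconjBy r (g.k ⊗ₜ h.k) (g.k ⊗ₜ h.k) := by
  obtain ⟨n, hn⟩ : ∃ n : A ⊗[ℂ] B, n = (1 - I) • (g.e * g.k) ⊗ₜ (h.f * h.k) := ⟨_, rfl⟩
  have n_sq : n ^ 2 = 0 := by simp [hn, sq, mul_assoc, hg.ordering_rules]
  refine ⟨1 + n, IsNilpotent.isUnit_one_add ⟨2, n_sq⟩, ?_, ?_, ?_⟩ <;>
    simp only [SemiconjBy, hn, hh.k_pow_three,
      mul_add, add_mul, mul_sub, smul_mul_assoc, mul_smul_comm, mul_assoc, mul_neg,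
      tmul_rules, hg.ordering_rules, hh.ordering_rules, one_mul, mul_one] <;>
    match_scalars <;> grind [I_mul_I]

lemma exists_isIntertwiner_even_odd (hg : g.HasParity 1) (hh : h.HasParity (-1)) :
    ∃ r : A ⊗[ℂ] B, IsUnit r ∧ g.IsIntertwiner h r := by
  obtain ⟨r₁, unit₁, e₁, f₁, k₁⟩ := exists_diagonal_semiconjBy hg hh
  obtain ⟨r₂, unit₂, e₂, f₂, k₂⟩ := exists_unipotent_f_e_semiconjBy hg hh
  obtain ⟨r₃, unit₃, e₃, f₃, k₃⟩ := exists_unipotent_e_f_semiconjBy hg hh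
  exact ⟨r₃ * (r₂ * r₁), unit₃.mul (unit₂.mul unit₁), e₃.mul_left (e₂.mul_left e₁),
    f₃.mul_left (f₂.mul_left f₁), k₃.mul_left (k₂.mul_left k₁)⟩

variable (g h) in
/-- On a tensor product of two simple modules with `K ^ 2 = -1` this is the flip up to signs. -/
def oddFlip : A ⊗[ℂ] B :=
  (g.f * g.e) ⊗ₜ (h.f * h.e) - (g.e * g.f * g.k) ⊗ₜ (h.e * h.f * h.k) +
    I • ((g.e * g.k) ⊗ₜ h.f - (g.f * g.k) ⊗ₜ h.e)

lemma isUnit_oddFlip (hg : g.HasParity (-1)) (hh : h.HasParity (-1)) : IsUnit (g.oddFlip h) := by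
  obtain ⟨r, hr⟩ : ∃ r : A ⊗[ℂ] B,
    r = (g.f * g.e) ⊗ₜ (h.f * h.e) - (g.e * g.f * g.k) ⊗ₜ (h.e * h.f * h.k) +
      I • (g.f ⊗ₜ (h.e * h.k) - g.e ⊗ₜ (h.f * h.k)) := ⟨_, rfl⟩
  refine ⟨⟨g.oddFlip h, r, ?_, ?_⟩, rfl⟩ <;>
    simp only [oddFlip, hr, Algebra.TensorProduct.one_def, mul_add, add_mul, sub_mul, mul_sub,
      smul_mul_assoc, mul_smul_comm, mul_assoc, mul_neg, mul_zero, tmul_rules,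
      hg.ordering_rules, hh.ordering_rules, mul_one] <;>
    match_scalars <;> grind [I_mul_I]

lemma oddFlip_semiconjBy_e (hg : g.HasParity (-1)) (hh : h.HasParity (-1)) :
    SemiconjBy (g.oddFlip h) (1 ⊗ₜ h.e + g.e ⊗ₜ h.k) (g.e ⊗ₜ 1 + g.k ⊗ₜ h.e) := by
  simp only [SemiconjBy, oddFlip, mul_add, add_mul, sub_mul, mul_sub,
    smul_mul_assoc, mul_smul_comm, mul_assoc, mul_neg, tmul_rules,
    hg.ordering_rules, hh.ordering_rules, one_mul, mul_one]
  match_scalars <;> grind [I_mul_I]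

lemma oddFlip_semiconjBy_f (hg : g.HasParity (-1)) (hh : h.HasParity (-1)) :
    SemiconjBy (g.oddFlip h) ((g.k ^ 3) ⊗ₜ h.f + g.f ⊗ₜ 1) (g.f ⊗ₜ (h.k ^ 3) + 1 ⊗ₜ h.f) := by
  simp only [SemiconjBy, oddFlip, hg.k_pow_three, hh.k_pow_three, mul_add, add_mul, sub_mul,
    mul_sub, smul_mul_assoc, mul_smul_comm, mul_assoc, mul_neg, mul_zero, tmul_rules,
    hg.ordering_rules, hh.ordering_rules, one_mul, mul_one]
  match_scalars <;> grind [I_mul_I]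

lemma oddFlip_semiconjBy_k (hg : g.HasParity (-1)) (hh : h.HasParity (-1)) :
    SemiconjBy (g.oddFlip h) (g.k ⊗ₜ h.k) (g.k ⊗ₜ h.k) := by
  simp only [SemiconjBy, oddFlip, mul_add, add_mul, sub_mul, mul_sub,
    smul_mul_assoc, mul_smul_comm, mul_assoc, mul_neg, tmul_rules,
    hg.ordering_rules, hh.ordering_rules, mul_one]
  match_scalars <;> grind [I_mul_I]

lemma exists_isIntertwiner_odd_odd (hg : g.HasParity (-1)) (hh : h.HasParity (-1)) :
    ∃ r : A ⊗[ℂ] B, IsUnit r ∧ g.IsIntertwiner h r :=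
  ⟨g.oddFlip h, isUnit_oddFlip hg hh, oddFlip_semiconjBy_e hg hh, oddFlip_semiconjBy_f hg hh,
    oddFlip_semiconjBy_k hg hh⟩

end Intertwiners

end GeneratorImages

end Q

end RestrictedQuantumGroup

/-! ### Direct sums of representations -/

namespace FinDimRep

section Prod

variable {k H : Type} [Field k] [Ring H] [Algebra k H]

/-- The action on the direct sum of two representations, realised on the product. -/
def prodAct {V W : Type} [AddCommGroup V] [Module k V] [AddCommGroup W] [Module k W]
    (ρ : H →ₐ[k] Module.End k V) (σ : H →ₐ[k] Module.End k W) : H →ₐ[k] Module.End k (V × W) :=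
  (LinearMap.prodMapAlgHom k V W).comp (ρ.prod σ)

/-- The direct sum of two representations. -/
def prod (X Y : FinDimRep k H) : FinDimRep k H where
  V := X.V × Y.V
  ρ := prodAct X.ρ Y.ρ

/-- The subrepresentation on an invariant subspace. -/
def restrict (X : FinDimRep k H) (p : Submodule k X.V) (hp : ∀ a, ∀ x ∈ p, X.ρ a x ∈ p) :
    FinDimRep k H where
  V := p
  ρ := AlgHom.ofLinearMap
    { toFun := fun a => (X.ρ a).restrict (hp a)
      map_add' := fun a b => by ext; simp
      map_smul' := fun c a => by ext; simp }
    (by ext; simp) fun a b => by ext; simp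

lemma nonempty_iso_prod_of_nonempty_iso {X X' Y Y' : FinDimRep k H} :
    Nonempty (X ≅ X') → Nonempty (Y ≅ Y') → Nonempty (X.prod Y ≅ X'.prod Y')
  | ⟨e⟩, ⟨f⟩ => ⟨{
      hom := ⟨e.hom.hom.prodMap f.hom.hom, fun a => LinearMap.ext fun x => Prod.ext
        (LinearMap.congr_fun (e.hom.comm a) x.1) (LinearMap.congr_fun (f.hom.comm a) x.2)⟩
      inv := ⟨e.inv.hom.prodMap f.inv.hom, fun a => LinearMap.ext fun x => Prod.ext
        (LinearMap.congr_fun (e.inv.comm a) x.1) (LinearMap.congr_fun (f.inv.comm a) x.2)⟩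
      hom_inv_id := hom_ext <| LinearMap.ext fun x => Prod.ext
        (LinearMap.congr_fun (congrArg Hom.hom e.hom_inv_id) x.1)
        (LinearMap.congr_fun (congrArg Hom.hom f.hom_inv_id) x.2)
      inv_hom_id := hom_ext <| LinearMap.ext fun x => Prod.ext
        (LinearMap.congr_fun (congrArg Hom.hom e.inv_hom_id) x.1)
        (LinearMap.congr_fun (congrArg Hom.hom f.inv_hom_id) x.2) }⟩

lemma exists_iso_prod_of_isIdempotentElem {e : H} (he : IsIdempotentElem e)
    (central : ∀ a, Commute e a) (X : FinDimRep k H) :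
    ∃ Y Z : FinDimRep k H, Nonempty (Y.prod Z ≅ X) ∧ Y.ρ e = 1 ∧ Z.ρ e = 0 := by
  have idem : IsIdempotentElem (X.ρ e) := he.map X.ρ
  have commutes (a : H) (x : X.V) : X.ρ e (X.ρ a x) = X.ρ a (X.ρ e x) :=
    LinearMap.congr_fun ((central a).map X.ρ).eq x
  have range_invariant (a : H) :
      ∀ x ∈ LinearMap.range (X.ρ e), X.ρ a x ∈ LinearMap.range (X.ρ e) := by
    rintro _ ⟨x, rfl⟩
    exact ⟨X.ρ a x, commutes a x⟩
  have ker_invariant (a : H) (x) (hx : x ∈ LinearMap.ker (X.ρ e)) :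
      X.ρ a x ∈ LinearMap.ker (X.ρ e) := by
    rw [LinearMap.mem_ker] at hx ⊢
    rw [commutes, hx, map_zero]
  refine ⟨X.restrict _ range_invariant, X.restrict _ ker_invariant,
    ⟨mkIso (Submodule.prodEquivOfIsCompl _ _ (LinearMap.IsIdempotentElem.isCompl idem))
      fun a => ?_⟩, ?_, ?_⟩
  · exact LinearMap.ext fun ⟨x, y⟩ => (map_add (X.ρ a) x.1 y.1).symm
  · exact LinearMap.ext fun x =>
      Subtype.ext ((LinearMap.IsIdempotentElem.mem_range_iff idem).mp x.2)
  · exact LinearMap.ext fun x => Subtype.ext x.2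

lemma prodLeft_comp_act₂ {V W U : Type} [AddCommGroup V] [Module k V] [AddCommGroup W]
    [Module k W] [AddCommGroup U] [Module k U] (ρ : H →ₐ[k] Module.End k V)
    (σ : H →ₐ[k] Module.End k W) (τ : H →ₐ[k] Module.End k U) (z : H ⊗[k] H) :
    (TensorProduct.prodLeft k k V W U).toLinearMap ∘ₗ act₂ (prodAct ρ σ) τ z =
      (act₂ ρ τ z).prodMap (act₂ σ τ z) ∘ₗ (TensorProduct.prodLeft k k V W U).toLinearMap := by
  induction z with
  | zero => simp
  | add x y hx hy =>
    simp only [map_add, LinearMap.comp_add, LinearMap.prodMap_add, LinearMap.add_comp, hx, hy]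
  | tmul a b => exact TensorProduct.ext' fun _ _ => rfl

lemma prodRight_comp_act₂ {V W U : Type} [AddCommGroup V] [Module k V] [AddCommGroup W]
    [Module k W] [AddCommGroup U] [Module k U] (ρ : H →ₐ[k] Module.End k V)
    (σ : H →ₐ[k] Module.End k W) (τ : H →ₐ[k] Module.End k U) (z : H ⊗[k] H) :
    (TensorProduct.prodRight k k V W U).toLinearMap ∘ₗ act₂ ρ (prodAct σ τ) z =
      (act₂ ρ σ z).prodMap (act₂ ρ τ z) ∘ₗ (TensorProduct.prodRight k k V W U).toLinearMap := by
  induction z with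
  | zero => simp
  | add x y hx hy =>
    simp only [map_add, LinearMap.comp_add, LinearMap.prodMap_add, LinearMap.add_comp, hx, hy]
  | tmul a b => exact TensorProduct.ext' fun _ _ => rfl

end Prod

section TensorProd

variable {k H : Type} [Field k] [Ring H] [Bialgebra k H]

/-- Distributivity of the tensor product over the direct sum, on the left. -/
def prodTensorIso (X Y Z : FinDimRep k H) : X.prod Y ⊗ Z ≅ (X ⊗ Z).prod (Y ⊗ Z) :=
  mkIso (X := tensor (X.prod Y) Z) (Y := (tensor X Z).prod (tensor Y Z))
    (TensorProduct.prodLeft k k X.V Y.V Z.V) fun _ => prodLeft_comp_act₂ X.ρ Y.ρ Z.ρ _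

/-- Distributivity of the tensor product over the direct sum, on the right. -/
def tensorProdIso (X Y Z : FinDimRep k H) : Z ⊗ X.prod Y ≅ (Z ⊗ X).prod (Z ⊗ Y) :=
  mkIso (X := tensor Z (X.prod Y)) (Y := (tensor Z X).prod (tensor Z Y))
    (TensorProduct.prodRight k k Z.V X.V Y.V) fun _ => prodRight_comp_act₂ Z.ρ X.ρ Y.ρ _

lemma nonempty_tensor_comm_of_iso_prod {W X Y Z : FinDimRep k H} (e : X.prod Y ≅ W)
    (hX : Nonempty (X ⊗ Z ≅ Z ⊗ X)) (hY : Nonempty (Y ⊗ Z ≅ Z ⊗ Y)) :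
    Nonempty (W ⊗ Z ≅ Z ⊗ W) := by
  obtain ⟨f⟩ := nonempty_iso_prod_of_nonempty_iso hX hY
  exact ⟨whiskerRightIso e.symm Z ≪≫ prodTensorIso X Y Z ≪≫ f ≪≫ (tensorProdIso X Y Z).symm ≪≫
    whiskerLeftIso Z e⟩

end TensorProd

end FinDimRep

/-! ### Commutativity of the tensor product -/

namespace RestrictedQuantumGroup

namespace Q

/-- The images of the generators under an algebra map. -/
def GeneratorImages.ofAlgHom {A : Type*} [Ring A] [Algebra ℂ A] (φ : Q →ₐ[ℂ] A) :
    GeneratorImages A where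
  e := φ E
  f := φ F
  k := φ K
  k_pow_four := by rw [← map_pow, K_pow_four, map_one]
  k_mul_e := by rw [← map_mul, K_mul_E, map_neg, map_mul]
  k_mul_f := by rw [← map_mul, K_mul_F, map_neg, map_mul]
  e_f_sub := by simp [← map_mul, ← map_sub, ← map_pow, ← map_smul, F_mul_E, Kinv_eq]
  e_mul_e := by rw [← map_mul, E_mul_E, map_zero]
  f_mul_f := by rw [← map_mul, F_mul_F, map_zero]

lemma semiconjBy_of_generators {A : Type*} [Ring A] [Algebra ℂ A] {φ ψ : Q →ₐ[ℂ] A} {r : A}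
    (hE : SemiconjBy r (φ E) (ψ E)) (hF : SemiconjBy r (φ F) (ψ F))
    (hK : SemiconjBy r (φ K) (ψ K)) (a : Q) : SemiconjBy r (φ a) (ψ a) := by
  induction a using induction_gen with
  | hc c => simpa only [AlgHom.commutes] using (Algebra.commute_algebraMap_right c r).semiconjBy
  | hE => exact hE
  | hF => exact hF
  | hK => exact hK
  | hKinv => simpa only [Kinv_eq, map_pow] using hK.pow_right 3
  | hadd a b ha hb => simpa only [map_add] using ha.add_right hb
  | hmul a b ha hb => simpa only [map_mul] using ha.mul_right hb

lemma GeneratorImages.IsIntertwiner.semiconjBy {A B : Type*} [Ring A] [Algebra ℂ A] [Ring B]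
    [Algebra ℂ B] {φ : Q →ₐ[ℂ] A} {ψ : Q →ₐ[ℂ] B} {r : A ⊗[ℂ] B}
    (hr : (ofAlgHom φ).IsIntertwiner (ofAlgHom ψ) r) (a : Q) :
    SemiconjBy r (Algebra.TensorProduct.map φ ψ (comulHom a))
      (Algebra.TensorProduct.map φ ψ (TensorProduct.comm ℂ Q Q (comulHom a))) := by
  refine semiconjBy_of_generators (φ := (Algebra.TensorProduct.map φ ψ).comp comulHom)
    (ψ := (Algebra.TensorProduct.map φ ψ).comp
      ((Algebra.TensorProduct.comm ℂ Q Q).toAlgHom.comp comulHom)) ?_ ?_ ?_ a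
  · simpa [ofAlgHom, add_comm] using hr.semiconjBy_e
  · simpa [ofAlgHom, Kinv_eq] using hr.semiconjBy_f
  · simpa [ofAlgHom] using hr.semiconjBy_k

lemma nonempty_tensor_comm_of_isIntertwiner {X Y : FinDimRep ℂ Q}
    (h : ∃ r, IsUnit r ∧ (GeneratorImages.ofAlgHom X.ρ).IsIntertwiner (.ofAlgHom Y.ρ) r) :
    Nonempty (X ⊗ Y ≅ Y ⊗ X) := by
  obtain ⟨r, r_unit, hr⟩ := h
  exact ⟨FinDimRep.flipIso X Y (Units.map Module.endTensorEndAlgHom.toMonoidHom r_unit.unit)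
    fun a => (hr.semiconjBy a).map (Module.endTensorEndAlgHom (R := ℂ) (S := ℂ) (A := ℂ))⟩

lemma commute_K_sq (a : Q) : Commute (K ^ 2) a := by
  refine semiconjBy_of_generators (φ := AlgHom.id ℂ Q) (ψ := AlgHom.id ℂ Q) ?_ ?_ ?_ a
  · simp [SemiconjBy, sq, mul_assoc, K_mul_E, ← mul_assoc K E]
  · simp [SemiconjBy, sq, mul_assoc, K_mul_F, ← mul_assoc K F]
  · exact (Commute.refl K).pow_left 2

lemma exists_iso_prod_even_odd (X : FinDimRep ℂ Q) : ∃ Y Z : FinDimRep ℂ Q,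
    Nonempty (Y.prod Z ≅ X) ∧ (GeneratorImages.ofAlgHom Y.ρ).HasParity 1 ∧
      (GeneratorImages.ofAlgHom Z.ρ).HasParity (-1) := by
  obtain ⟨e, he⟩ : ∃ e : Q, e = (2⁻¹ : ℂ) • (1 + K ^ 2) := ⟨_, rfl⟩
  have K_sq_eq : K ^ 2 = (2 : ℂ) • e - 1 := by rw [he]; module
  have idem : IsIdempotentElem e := by
    have K_sq_mul_K_sq : K ^ 2 * K ^ 2 = 1 := by rw [← pow_add, K_pow_four]
    rw [IsIdempotentElem, he, smul_mul_smul_comm, add_mul, mul_add, mul_add, K_sq_mul_K_sq]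
    simp only [one_mul, mul_one]
    module
  have central (a : Q) : Commute e a := by
    rw [he]
    exact ((Commute.one_left a).add_left (commute_K_sq a)).smul_left _
  have parity (Y : FinDimRep ℂ Q) : Y.ρ K * Y.ρ K = (2 : ℂ) • Y.ρ e - 1 := by
    rw [← map_mul, ← sq, K_sq_eq, map_sub, map_smul, map_one]
  obtain ⟨Y, Z, iso, hY, hZ⟩ := FinDimRep.exists_iso_prod_of_isIdempotentElem idem central X
  refine ⟨Y, Z, iso, (parity Y).trans ?_, (parity Z).trans ?_⟩
  · rw [hY]; module
  · rw [hZ]; module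

open GeneratorImages in
theorem nonempty_tensor_comm (U V : FinDimRep ℂ Q) : Nonempty (U ⊗ V ≅ V ⊗ U) := by
  obtain ⟨U₀, U₁, ⟨eU⟩, hU₀, hU₁⟩ := exists_iso_prod_even_odd U
  obtain ⟨V₀, V₁, ⟨eV⟩, hV₀, hV₁⟩ := exists_iso_prod_even_odd V
  have comm_of_pieces {X : FinDimRep ℂ Q} (h₀ : Nonempty (X ⊗ V₀ ≅ V₀ ⊗ X))
      (h₁ : Nonempty (X ⊗ V₁ ≅ V₁ ⊗ X)) : Nonempty (X ⊗ V ≅ V ⊗ X) :=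
    (FinDimRep.nonempty_tensor_comm_of_iso_prod eV (h₀.map .symm) (h₁.map .symm)).map .symm
  refine FinDimRep.nonempty_tensor_comm_of_iso_prod eU (comm_of_pieces ?_ ?_) (comm_of_pieces ?_ ?_)
  · exact nonempty_tensor_comm_of_isIntertwiner (exists_isIntertwiner_even_even hU₀ hV₀)
  · exact nonempty_tensor_comm_of_isIntertwiner (exists_isIntertwiner_even_odd hU₀ hV₁)
  · exact (nonempty_tensor_comm_of_isIntertwiner (exists_isIntertwiner_even_odd hV₀ hU₁)).map .symm
  · exact nonempty_tensor_comm_of_isIntertwiner (exists_isIntertwiner_odd_odd hU₁ hV₁)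

end Q

end RestrictedQuantumGroup

end

theorem theorem1 :
    Module.finrank ℂ RestrictedQuantumGroup.Q = 16 ∧
    IsEmpty (BraidedCategory (FinDimRep ℂ RestrictedQuantumGroup.Q)) ∧
    (¬ ∃ R : RestrictedQuantumGroup.Q ⊗[ℂ] RestrictedQuantumGroup.Q, IsUniversalRMatrix ℂ R) ∧
    ∀ U V : FinDimRep ℂ RestrictedQuantumGroup.Q, Nonempty (U ⊗ V ≅ V ⊗ U) :=
  ⟨RestrictedQuantumGroup.Q.finrank_eq, RestrictedQuantumGroup.Q.isEmpty_braidedCategory,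
    RestrictedQuantumGroup.Q.not_exists_isUniversalRMatrix,
    RestrictedQuantumGroup.Q.nonempty_tensor_comm⟩
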